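/- Let $\mathbb D=\{z\in\mathbb C:|z|<1\}$ and $x_+=\max(x,0)$. Let $\xi_1,\dots,\xi_N$ be distinct points of the unit circle, let $\alpha,\gamma,\beta_1,\dots,\beta_N\ge 0$, and let $0<\tau<1$. Then there is a constant $C>0$, depending only on $\alpha$, $\{\beta_j\}$, $\gamma$, $\{\xi_j\}$ and $\tau$, with the following property. Let $K\in\mathbb R$ and let $h:\mathbb D\to\mathbb C$ be holomorphic with $h(0)=1$ and $$\log|h(z)|\le K\,\frac{|z|^{\gamma}}{(1-|z|)^{\alpha}}\prod_{j=1}^N\frac{1}{|z-\xi_j|^{\beta_j}}\qquad(z\in\mathbb D),$$ where $\log 0=-\infty$ and $0^0=1$. Then $$\sum_{z\in\mathbb D,\;h(z)=0}\frac{(1-|z|)^{\alpha+1+\tau}}{|z|^{(\gamma-1+\tau)_+}}\prod_{j=1}^N|z-\xi_j|^{(\beta_j-1+\tau)_+}\le C\,K,$$ where each zero of $h$ is counted according to its multiplicity; in particular, the sum converges. -/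

import Mathlib

/-- The open unit disc in the complex plane. -/
abbrev unitDisc : Set ℂ := Metric.ball 0 1

/-- The weight
`(1 - |z|)^(α + 1 + τ) / |z|^((γ - 1 + τ)₊) * ∏ j, |z - ξ j|^((β j - 1 + τ)₊)`. -/
noncomputable def zeroWeight {N : ℕ} (ξ : Fin N → ℂ) (β : Fin N → ℝ) (α γ τ : ℝ) (z : ℂ) : ℝ :=
  (1 - ‖z‖) ^ (α + 1 + τ) / ‖z‖ ^ max (γ - 1 + τ) 0 * ∏ j, ‖z - ξ j‖ ^ max (β j - 1 + τ) 0

/-! Put `u = log |h|`, `p = α + 1 + τ > 1` and `b_j = (β_j - 1 + τ)₊`, and let `φ = (1 - |z|²)^p ∏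
|z - ξ_j|^(b_j)`. The proof is a discrete Green's formula for `u` and `φ`, with the hyperbolic
Laplacian replaced by the operator "integral over the hyperbolic disc of radius `ρ`, minus `Λ` times
the value at the centre", where `Λ` is the hyperbolic area of that disc. Since the pseudohyperbolic
distance is symmetric and hyperbolic area is invariant, this operator is self-adjoint
(`integral_mul_hypMean_comm`).

Applied to `u`, the operator is nonnegative off the zeros, and Jensen's formula makes it at least a
fixed constant times the number of zeros close to the centre (`add_sum_order_le_hypMean`).
Integrated against `φ`, which is comparable at nearby points, it dominates `∑ φ(z)` over the zeros.
Applied to `φ`, it is bounded by a multiple of `φ`, and near the boundary it is nonnegative, because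
`p > 1` (`exists_discWeight_le_circleAverage`). There `u` may be replaced by `u₊`. On the remaining
compact part, `∫ |u| ≤ 2 ∫ u₊`, because `u(0) = 0` and circle means of `u` are nonnegative. Hence `∑
φ(z) ≤ C ∫ u₊ φ` for bounded `h` (`exists_sum_order_mul_discWeight_le`).

Inserting the growth hypothesis leaves an integral whose Euclidean density is of order `(1 -
|z|)^(τ-1) ∏ |z - ξ_j|^(τ-1)` at worst; it is finite because `τ > 0` and the `ξ_j` are distinct.
Dilations `h(Rz)`, `R → 1`, remove the boundedness assumption.

The weight `φ` ignores the factor `|z|^(-(γ-1+τ)₊)`, which matters only near the origin. There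
Jensen's formula on circles of dyadic radii `r` bounds the zeros by a multiple of `K r^γ`, and the
weighted bounds sum as a geometric series of ratio `2^(τ-1)` (`exists_sum_order_mul_rpow_le`). -/

section

/-! ### Möbius automorphisms of the disc. -/

open MeasureTheory Metric Set ComplexConjugate

/-- The involutive automorphism of the unit disc exchanging `0` and `w`. -/
noncomputable def mob (w z : ℂ) : ℂ := (w - z) / (1 - conj w * z)

lemma one_sub_conj_mul_ne_zero {w z : ℂ} (hw : ‖w‖ < 1) (hz : ‖z‖ ≤ 1) : 1 - conj w * z ≠ 0 := by
  intro h
  have h1 : conj w * z = 1 := (sub_eq_zero.1 h).symm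
  have h2 : ‖w‖ * ‖z‖ = 1 := by
    have := congrArg norm h1
    simpa using this
  nlinarith [norm_nonneg w, norm_nonneg z]

lemma one_sub_norm_mob_sq {w z : ℂ} (hw : ‖w‖ < 1) (hz : ‖z‖ ≤ 1) :
    1 - ‖mob w z‖ ^ 2 = (1 - ‖w‖ ^ 2) * (1 - ‖z‖ ^ 2) / ‖1 - conj w * z‖ ^ 2 := by
  have h0 : ‖1 - conj w * z‖ ^ 2 ≠ 0 := by
    simpa using one_sub_conj_mul_ne_zero hw hz
  rw [mob, norm_div, div_pow, eq_div_iff h0, sub_mul, div_mul_cancel₀ _ h0]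
  simp only [← Complex.normSq_eq_norm_sq, Complex.normSq_apply, Complex.sub_re, Complex.sub_im,
    Complex.mul_re, Complex.mul_im, Complex.conj_re, Complex.conj_im, Complex.one_re,
    Complex.one_im]
  ring

lemma norm_mob_lt_one {w z : ℂ} (hw : ‖w‖ < 1) (hz : ‖z‖ < 1) : ‖mob w z‖ < 1 := by
  have h0 : 0 < ‖1 - conj w * z‖ := norm_pos_iff.2 (one_sub_conj_mul_ne_zero hw hz.le)
  have h1 := one_sub_norm_mob_sq hw hz.le
  have h2 : 0 < (1 - ‖w‖ ^ 2) * (1 - ‖z‖ ^ 2) / ‖1 - conj w * z‖ ^ 2 := by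
    have : 0 < 1 - ‖w‖ ^ 2 := by nlinarith [norm_nonneg w]
    have : 0 < 1 - ‖z‖ ^ 2 := by nlinarith [norm_nonneg z]
    positivity
  nlinarith [norm_nonneg (mob w z)]

lemma mob_mob {w z : ℂ} (hw : ‖w‖ < 1) (hz : ‖z‖ < 1) : mob w (mob w z) = z := by
  have h0 := one_sub_conj_mul_ne_zero hw hz.le
  have h1 := one_sub_conj_mul_ne_zero hw (norm_mob_lt_one hw hz).le
  have hq : mob w z * (1 - conj w * z) = w - z := div_mul_cancel₀ _ h0
  rw [mob, div_eq_iff h1]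
  linear_combination -hq

/-- Symmetry of the pseudohyperbolic distance, which is what makes hyperbolic means self-adjoint. -/
lemma norm_mob_comm (w z : ℂ) : ‖mob w z‖ = ‖mob z w‖ := by
  rw [mob, mob, norm_div, norm_div, norm_sub_rev]
  congr 1
  rw [← Complex.norm_conj]
  simp [mul_comm]

@[simp] lemma mob_zero (w : ℂ) : mob w 0 = w := by simp [mob]

lemma hasDerivAt_mob {w z : ℂ} (hw : ‖w‖ < 1) (hz : ‖z‖ ≤ 1) :
    HasDerivAt (mob w) ((conj w * w - 1) / (1 - conj w * z) ^ 2) z := by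
  have h0 := one_sub_conj_mul_ne_zero hw hz
  have h1 : HasDerivAt (fun z => w - z) (-1) z := by simpa using (hasDerivAt_id z).const_sub w
  have h2 : HasDerivAt (fun z => 1 - conj w * z) (-conj w) z := by
    simpa using ((hasDerivAt_id z).const_mul (conj w)).const_sub 1
  have h3 : conj w * w - 1 = -1 * (1 - conj w * z) - (w - z) * (-conj w) := by ring
  rw [h3]
  exact h1.div h2 h0

lemma conj_mul_self_sub_one (w : ℂ) : ‖conj w * w - 1‖ = |1 - ‖w‖ ^ 2| := by
  rw [Complex.conj_mul', norm_sub_rev, ← Complex.ofReal_pow, ← Complex.ofReal_one,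
    ← Complex.ofReal_sub, Complex.norm_real, Real.norm_eq_abs]

@[fun_prop]
lemma measurable_mob : Measurable (fun x : ℂ × ℂ => mob x.1 x.2) := by
  unfold mob
  fun_prop

/-! ### Hyperbolic area and its invariance. -/

/-- Hyperbolic area on the unit disc. -/
noncomputable def hypArea : Measure ℂ :=
  (volume.restrict unitDisc).withDensity fun z => ENNReal.ofReal ((1 - ‖z‖ ^ 2) ^ 2)⁻¹

lemma measurable_hypDensity :
    Measurable fun z : ℂ => ENNReal.ofReal ((1 - ‖z‖ ^ 2) ^ 2)⁻¹ := by fun_prop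

instance : SFinite hypArea := by unfold hypArea; infer_instance

lemma mem_unitDisc {z : ℂ} : z ∈ unitDisc ↔ ‖z‖ < 1 := by simp [unitDisc]

lemma ae_hypArea_mem : ∀ᵐ z ∂hypArea, ‖z‖ < 1 := by
  have h : ∀ᵐ z ∂(volume.restrict unitDisc), ‖z‖ < 1 := by
    filter_upwards [ae_restrict_mem measurableSet_ball] with z hz
    exact mem_unitDisc.1 hz
  exact (withDensity_absolutelyContinuous _ _).ae_le h

lemma det_restrictScalars_smulRight (a : ℂ) :
    |((ContinuousLinearMap.toSpanSingleton ℂ a).restrictScalars ℝ).det| = ‖a‖ ^ 2 := by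
  simp [ContinuousLinearMap.det, LinearMap.det_restrictScalars,
      Algebra.norm_complex_eq, Complex.normSq_eq_norm_sq]

/-- Hyperbolic isometries preserve hyperbolic area. -/
lemma measurePreserving_hypArea {T T' : ℂ → ℂ} (hT : Measurable T)
    (hbij : BijOn T unitDisc unitDisc) (hderiv : ∀ z ∈ unitDisc, HasDerivAt T (T' z) z)
    (hnorm : ∀ z ∈ unitDisc, ‖T' z‖ * (1 - ‖z‖ ^ 2) = 1 - ‖T z‖ ^ 2) :
    MeasurePreserving T hypArea hypArea := by
  refine ⟨hT, ?_⟩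
  ext s hs
  rw [Measure.map_apply hT hs, hypArea, withDensity_apply _ (hT hs), withDensity_apply _ hs,
    Measure.restrict_restrict (hT hs), Measure.restrict_restrict hs]
  have himg : s ∩ unitDisc = T '' (T ⁻¹' s ∩ unitDisc) := by
    rw [image_preimage_inter, hbij.image_eq]
  rw [himg, lintegral_image_eq_lintegral_abs_det_fderiv_mul volume
    ((hT hs).inter measurableSet_ball)
    (f' := fun z => (ContinuousLinearMap.toSpanSingleton ℂ (T' z)).restrictScalars ℝ)
    (fun z hz => ((hderiv z hz.2).hasFDerivAt.restrictScalars ℝ).hasFDerivWithinAt)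
    (hbij.injOn.mono inter_subset_right)]
  refine setLIntegral_congr_fun ((hT hs).inter measurableSet_ball) fun z hz => ?_
  have hz1 : ‖z‖ < 1 := mem_unitDisc.1 hz.2
  have hz2 : ‖T z‖ < 1 := mem_unitDisc.1 (hbij.mapsTo hz.2)
  have h1 : 0 < 1 - ‖z‖ ^ 2 := by nlinarith [norm_nonneg z]
  have h2 : 0 < 1 - ‖T z‖ ^ 2 := by nlinarith [norm_nonneg (T z)]
  rw [det_restrictScalars_smulRight, ← ENNReal.ofReal_mul (by positivity)]
  congr 1
  have h3 := hnorm z hz.2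
  have h4 : 0 < ‖T' z‖ := by
    rcases (norm_nonneg (T' z)).eq_or_lt with h | h
    · rw [← h] at h3; linarith
    · exact h
  -- The Jacobian `|T'|²` is cancelled by the ratio of the two densities.
  rw [← h3]
  field_simp

lemma measurePreserving_mob {w : ℂ} (hw : ‖w‖ < 1) : MeasurePreserving (mob w) hypArea hypArea := by
  have hmaps : MapsTo (mob w) unitDisc unitDisc := fun z hz =>
    mem_unitDisc.2 (norm_mob_lt_one hw (mem_unitDisc.1 hz))
  have hinv : InvOn (mob w) (mob w) unitDisc unitDisc :=
    ⟨fun z hz => mob_mob hw (mem_unitDisc.1 hz), fun z hz => mob_mob hw (mem_unitDisc.1 hz)⟩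
  refine measurePreserving_hypArea (measurable_mob.comp (by fun_prop : Measurable fun z => (w, z)))
    (hinv.bijOn hmaps hmaps)
    (fun z hz => hasDerivAt_mob hw (mem_unitDisc.1 hz).le) fun z hz => ?_
  have hz1 := mem_unitDisc.1 hz
  rw [one_sub_norm_mob_sq hw hz1.le, norm_div, conj_mul_self_sub_one, norm_pow, abs_of_pos]
  · ring
  · nlinarith [norm_nonneg w]

lemma measurePreserving_rotation (c : ℂ) (hc : ‖c‖ = 1) :
    MeasurePreserving (fun z => c * z) hypArea hypArea := by
  have hc0 : c ≠ 0 := norm_ne_zero_iff.1 (by rw [hc]; norm_num)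
  refine measurePreserving_hypArea (by fun_prop) ⟨fun z hz => ?_, ?_, fun z hz => ?_⟩
    (T' := fun _ => c) (fun z hz => ?_) fun z hz => ?_
  · simpa [unitDisc, hc] using hz
  · exact (mul_right_injective₀ hc0).injOn
  · exact ⟨c⁻¹ * z, by simpa [unitDisc, hc] using hz, by field_simp⟩
  · simpa using (hasDerivAt_id z).const_mul c
  · simp [hc]

end

open MeasureTheory Metric Set Real Complex ComplexConjugate

/-! ### Rotation-invariant measures and circle averages. -/

/-- Rotation invariance of a measure on the plane. -/
def RotInvariant (μ : Measure ℂ) : Prop :=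
  ∀ θ : ℝ, MeasurePreserving (fun z => exp (θ * I) * z) μ μ

lemma rotInvariant_hypArea : RotInvariant hypArea := fun θ =>
  measurePreserving_rotation _ (norm_exp_ofReal_mul_I θ)

lemma RotInvariant.restrict_ball {μ : Measure ℂ} (hμ : RotInvariant μ) (ρ : ℝ) :
    RotInvariant (μ.restrict (ball 0 ρ)) := by
  intro θ
  have h := (hμ θ).restrict_preimage (s := ball (0 : ℂ) ρ) measurableSet_ball
  have h2 : (fun z => exp (θ * I) * z) ⁻¹' ball (0 : ℂ) ρ = ball 0 ρ := by
    ext z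
    simp [norm_exp_ofReal_mul_I]
  rwa [h2] at h

lemma intervalIntegral_rotation (F : ℂ → ℝ) (z : ℂ) :
    ∫ θ in Ioc 0 (2 * π), F (exp (θ * I) * z) = 2 * π * circleAverage F 0 ‖z‖ := by
  rw [circleAverage_eq_integral_add z.arg, ← intervalIntegral.integral_of_le two_pi_pos.le,
    smul_eq_mul, ← mul_assoc, mul_inv_cancel₀ two_pi_pos.ne', one_mul]
  congr with θ
  congr 1
  conv_lhs => rw [← norm_mul_exp_arg_mul_I z]
  rw [circleMap_zero]
  push_cast
  rw [add_mul, Complex.exp_add]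
  ring

lemma integrableOn_rotation {F : ℂ → ℝ} {z : ℂ} (h : CircleIntegrable F 0 ‖z‖) :
    IntegrableOn (fun θ : ℝ => F (exp (θ * I) * z)) (Ioc 0 (2 * π)) := by
  have h1 : Function.Periodic (fun θ => F (circleMap 0 ‖z‖ θ)) (2 * π) :=
    (periodic_circleMap 0 ‖z‖).comp F
  have h2 := (h1.intervalIntegrable₀ two_pi_pos.ne' h (z.arg) (z.arg + 2 * π)).comp_add_right z.arg
  simp only [sub_self, add_sub_cancel_left] at h2
  rw [intervalIntegrable_iff_integrableOn_Ioc_of_le two_pi_pos.le] at h2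
  refine h2.congr_fun (fun θ _ => ?_) measurableSet_Ioc
  simp only
  congr 1
  conv_rhs => rw [← norm_mul_exp_arg_mul_I z]
  rw [circleMap_zero]
  push_cast
  rw [add_mul, Complex.exp_add]
  ring

/-- Averaging over an extra angle `θ` replaces polar coordinates: this shear lets Fubini's theorem
exchange `F(z)` for its circle averages. -/
lemma measurePreserving_skewRotation {μ : Measure ℂ} [SFinite μ] (hμ : RotInvariant μ) :
    MeasurePreserving (fun x : ℝ × ℂ => (x.1, exp (x.1 * I) * x.2))
      ((volume.restrict (Ioc 0 (2 * π))).prod μ) ((volume.restrict (Ioc 0 (2 * π))).prod μ) :=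
  (MeasurePreserving.id _).skew_product (g := fun (θ : ℝ) z => exp (θ * I) * z) (by fun_prop)
    (Filter.Eventually.of_forall fun θ => (hμ θ).map_eq)

/-- Integration in polar coordinates, in the form of averaging over rotations. -/
lemma integral_circleAverage {μ : Measure ℂ} [SFinite μ] (hμ : RotInvariant μ) {F : ℂ → ℝ}
    (hF : Integrable F μ) :
    Integrable (fun z => circleAverage F 0 ‖z‖) μ ∧
      ∫ z, circleAverage F 0 ‖z‖ ∂μ = ∫ z, F z ∂μ := by
  have h1 : Integrable (fun x : ℝ × ℂ => F (exp (x.1 * I) * x.2))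
      ((volume.restrict (Ioc 0 (2 * π))).prod μ) :=
    (measurePreserving_skewRotation hμ).integrable_comp_of_integrable
      (hF.comp_snd (volume.restrict (Ioc 0 (2 * π))))
  have h2 := h1.integral_prod_right
  simp only [intervalIntegral_rotation] at h2
  refine ⟨by simpa [mul_assoc] using h2.const_mul (2 * π)⁻¹, ?_⟩
  have h3 := integral_integral_swap (f := fun (θ : ℝ) z => F (exp (θ * I) * z)) h1
  simp only [intervalIntegral_rotation, integral_const_mul] at h3
  -- By invariance the inner integral does not depend on `θ`.
  have h4 : ∀ θ : ℝ, ∫ z, F (exp (θ * I) * z) ∂μ = ∫ z, F z ∂μ := fun θ =>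
    (hμ θ).integral_comp' (f := (Homeomorph.mulLeft₀ _ (exp_ne_zero (θ * I))).toMeasurableEquiv) F
  simp only [h4, setIntegral_const, smul_eq_mul] at h3
  rw [Measure.real, Real.volume_Ioc, sub_zero, ENNReal.toReal_ofReal two_pi_pos.le] at h3
  exact (mul_left_cancel₀ two_pi_pos.ne' h3).symm

/-- Tonelli's theorem makes the rotated function integrable on the product with the angle; undoing
the shear and restricting to one angle gives the claim. -/
lemma integrable_of_circleAverage_le {μ : Measure ℂ} [SFinite μ] (hμ : RotInvariant μ) {F : ℂ → ℝ}
    {m : ℂ → ℝ} (hF : AEStronglyMeasurable F μ) (hm : Integrable m μ)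
    (hint : ∀ᵐ z ∂μ, CircleIntegrable F 0 ‖z‖)
    (hle : ∀ᵐ z ∂μ, circleAverage (fun z => |F z|) 0 ‖z‖ ≤ m z) : Integrable F μ := by
  have hmp := measurePreserving_skewRotation hμ
  have h0 : AEStronglyMeasurable (fun x : ℝ × ℂ => F x.2)
    ((volume.restrict (Ioc 0 (2 * π))).prod μ) := hF.comp_snd
  have h1 : Integrable (fun x : ℝ × ℂ => F (exp (x.1 * I) * x.2))
      ((volume.restrict (Ioc 0 (2 * π))).prod μ) := by
    have hs : AEStronglyMeasurable (fun x : ℝ × ℂ => F (exp (x.1 * I) * x.2))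
      ((volume.restrict (Ioc 0 (2 * π))).prod μ) := h0.comp_measurePreserving hmp
    rw [integrable_prod_iff' hs]
    refine ⟨hint.mono fun z hz => integrableOn_rotation hz, ?_⟩
    refine (hm.const_mul (2 * π)).mono' ?_ ?_
    · exact hs.norm.prod_swap.integral_prod_right'
    · filter_upwards [hle] with z hz
      simp only [Real.norm_eq_abs]
      rw [intervalIntegral_rotation (fun z => |F z|), abs_mul, abs_of_pos two_pi_pos,
        abs_of_nonneg (circleAverage_nonneg_of_nonneg fun _ _ => abs_nonneg _)]
      gcongr
  have h2 : Integrable (fun x : ℝ × ℂ => F x.2) ((volume.restrict (Ioc 0 (2 * π))).prod μ) :=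
    (hmp.integrable_comp h0).1 h1
  rw [integrable_prod_iff h0] at h2
  have : (ae (volume.restrict (Ioc (0 : ℝ) (2 * π)))).NeBot := by
    rw [ae_neBot, Ne, Measure.restrict_eq_zero, Real.volume_Ioc]
    simp [pi_pos]
  exact h2.1.exists.choose_spec

/-! ### Jensen's formula and the first Parseval coefficients. -/

/-- The lower bound for circle averages contained in Jensen's formula. -/
lemma sum_order_mul_log_le_circleAverage {f : ℂ → ℂ} {r : ℝ} (hr : 0 < r)
    (hf : AnalyticOnNhd ℂ f (closedBall 0 r)) (h0 : f 0 ≠ 0) (S : Finset ℂ)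
    (hS : ∀ z ∈ S, ‖z‖ ≤ r) :
    ∑ z ∈ S, (analyticOrderNatAt f z : ℝ) * Real.log (r / ‖z‖) + Real.log ‖f 0‖ ≤
      circleAverage (fun z => Real.log ‖f z‖) 0 r := by
  have hr' : |r| = r := abs_of_pos hr
  have hf' : AnalyticOnNhd ℂ f (closedBall 0 |r|) := by rwa [hr']
  have hdiv : ∀ z, ‖z‖ ≤ r → (MeromorphicOn.divisor f (closedBall 0 |r|) z : ℝ) =
      (analyticOrderNatAt f z : ℝ) := by
    intro z hz
    rw [MeromorphicOn.AnalyticOnNhd.divisor_apply hf' (by simpa [hr'] using hz)]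
    rw [analyticOrderNatAt]
    cases analyticOrderAt f z using ENat.recTopCoe <;> simp
  rw [hf'.circleAverage_log_norm hr.ne' h0]
  gcongr
  have hfin := (MeromorphicOn.divisor f (closedBall 0 |r|)).finiteSupport
    (isCompact_closedBall 0 |r|)
  classical
  rw [finsum_eq_sum_of_support_subset (s := hfin.toFinset ∪ S)]
  · refine (Finset.sum_le_sum fun z hz => ?_).trans
      -- Zeros outside `S` may be dropped, their terms being nonnegative.
      (Finset.sum_le_sum_of_subset_of_nonneg Finset.subset_union_right fun z _ _ => ?_)
    · rw [hdiv z (hS z hz)]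
      simp [div_eq_mul_inv]
    · by_cases hz : ‖z‖ ≤ r
      · rw [hdiv z hz]
        rcases (norm_nonneg z).eq_or_lt with h | h
        · simp [← h]
        · refine mul_nonneg (Nat.cast_nonneg _) (Real.log_nonneg ?_)
          rw [zero_sub, norm_neg, ← div_eq_mul_inv, one_le_div h]
          exact hz
      · rw [Function.locallyFinsuppWithin.apply_eq_zero_of_notMem _ (by simpa [hr'] using hz)]
        simp
  · intro z hz
    simp only [Finset.coe_union, Set.mem_union, Set.Finite.coe_toFinset]
    left
    intro h
    apply hz
    simp [h]

/-- With `f(z) = f(0) + z k(z)`, the cross term is twice the real part of a holomorphic function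
vanishing at `0`, so it has mean zero. -/
lemma circleAverage_norm_sq_eq {f : ℂ → ℂ} (hf : DifferentiableOn ℂ f (ball 0 1)) {r : ℝ}
    (hr : 0 < r) (hr1 : r < 1) :
    circleAverage (fun z => ‖f z‖ ^ 2) 0 r =
      ‖f 0‖ ^ 2 + r ^ 2 * circleAverage (fun z => ‖dslope f 0 z‖ ^ 2) 0 r := by
  have hr' : |r| = r := abs_of_pos hr
  have hk : DifferentiableOn ℂ (dslope f 0) (ball 0 1) :=
    (differentiableOn_dslope (ball_mem_nhds 0 one_pos)).2 hf
  have hsub : closedBall (0 : ℂ) |r| ⊆ ball 0 1 := closedBall_subset_ball (by rwa [hr'])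
  have hsph : sphere (0 : ℂ) |r| ⊆ ball 0 1 := sphere_subset_closedBall.trans hsub
  set g : ℂ → ℂ := fun z => conj (f 0) * (z * dslope f 0 z) with hg
  have hgd : DifferentiableOn ℂ g (ball 0 1) := (differentiableOn_id.mul hk).const_mul _
  have hgavg : circleAverage g 0 r = 0 := by
    rw [(hgd.diffContOnCl_ball hsub).circleAverage, hg]
    simp
  have hgi : CircleIntegrable g 0 r := (hgd.continuousOn.mono hsph).circleIntegrable'
  have hre : circleAverage (fun z => (g z).re) 0 r = 0 := by
    have := reCLM.circleAverage_comp_comm hgi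
    rw [hgavg] at this
    simpa [Function.comp_def] using this
  have hki : CircleIntegrable (fun z => ‖dslope f 0 z‖ ^ 2) 0 r :=
    ((hk.continuousOn.mono hsph).norm.pow 2).circleIntegrable'
  have hrei : CircleIntegrable (fun z => (g z).re) 0 r :=
    (continuous_re.comp_continuousOn (hgd.continuousOn.mono hsph)).circleIntegrable'
  have hexp : EqOn (fun z => ‖f z‖ ^ 2)
      (fun z => (‖f 0‖ ^ 2 + 2 * (g z).re) + r ^ 2 * ‖dslope f 0 z‖ ^ 2) (sphere 0 |r|) := by
    intro z hz
    have hz' : ‖z‖ = r := by simpa [hr'] using hz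
    have h1 : f z = f 0 + z * dslope f 0 z := by
      have := sub_smul_dslope f 0 z
      simp only [sub_zero, smul_eq_mul] at this
      rw [this]
      ring
    simp only [hg]
    rw [h1, ← hz', ← mul_pow, ← norm_mul]
    generalize z * dslope f 0 z = a
    simp only [← normSq_eq_norm_sq, normSq_apply, add_re, add_im, mul_re, conj_re, conj_im]
    ring
  have hki' : CircleIntegrable (fun z => r ^ 2 * ‖dslope f 0 z‖ ^ 2) 0 r := hki.const_mul _
  have hrei' : CircleIntegrable (fun z => 2 * (g z).re) 0 r := hrei.const_mul _
  have hc : CircleIntegrable (fun _ => ‖f 0‖ ^ 2) 0 r := circleIntegrable_const _ _ _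
  have hsum : CircleIntegrable (fun z => ‖f 0‖ ^ 2 + 2 * (g z).re) 0 r := hc.add hrei'
  have e1 := circleAverage_fun_smul (a := (2 : ℝ)) (f := fun z => (g z).re) (c := 0) (R := r)
  have e2 := circleAverage_fun_smul (a := r ^ 2) (f := fun z => ‖dslope f 0 z‖ ^ 2) (c := 0) (R := r)
  simp only [smul_eq_mul] at e1 e2
  rw [circleAverage_congr_sphere hexp, circleAverage_fun_add hsum hki',
    circleAverage_fun_add hc hrei', circleAverage_const, e1, e2, hre, mul_zero, add_zero]

/-- Two rounds of the preceding identity split off the first two Taylor coefficients. -/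
lemma le_circleAverage_norm_sq {f : ℂ → ℂ} (hf : DifferentiableOn ℂ f (ball 0 1)) {r : ℝ}
    (hr : 0 < r) (hr1 : r < 1) :
    ‖f 0‖ ^ 2 + r ^ 2 * ‖deriv f 0‖ ^ 2 ≤ circleAverage (fun z => ‖f z‖ ^ 2) 0 r := by
  have hk : DifferentiableOn ℂ (dslope f 0) (ball 0 1) :=
    (differentiableOn_dslope (ball_mem_nhds 0 one_pos)).2 hf
  rw [circleAverage_norm_sq_eq hf hr hr1, circleAverage_norm_sq_eq hk hr hr1, dslope_same]
  gcongr
  have := circleAverage_nonneg_of_nonneg (c := 0) (R := r)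
    (f := fun z => ‖dslope (dslope f 0) 0 z‖ ^ 2) fun _ _ => by positivity
  nlinarith [sq_nonneg r]

/-! ### The weight and its comparison at nearby points. -/

section Weight

variable {N : ℕ} (ξ : Fin N → ℂ) (b : Fin N → ℝ) (p : ℝ)

/-- The weight `(1 - |z|²) ^ p * ∏ |z - ξ_j| ^ b_j`. -/
noncomputable def discWeight (z : ℂ) : ℝ := (1 - ‖z‖ ^ 2) ^ p * ∏ j, ‖z - ξ j‖ ^ b j

@[fun_prop]
lemma measurable_discWeight : Measurable (discWeight ξ b p) := by
  unfold discWeight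
  fun_prop

variable {ξ b p}

lemma one_sub_norm_sq_pos {z : ℂ} (hz : ‖z‖ < 1) : 0 < 1 - ‖z‖ ^ 2 := by
  nlinarith [norm_nonneg z]

lemma norm_sub_pos_of_lt {z a : ℂ} (hz : ‖z‖ < 1) (ha : ‖a‖ = 1) : 0 < ‖z - a‖ := by
  refine norm_pos_iff.2 fun h => ?_
  rw [sub_eq_zero.1 h] at hz
  linarith

lemma one_sub_norm_le {z a : ℂ} (ha : ‖a‖ = 1) : 1 - ‖z‖ ≤ ‖z - a‖ := by
  rw [← ha, norm_sub_rev]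
  exact norm_sub_norm_le a z

lemma discWeight_pos (hξ : ∀ j, ‖ξ j‖ = 1) {z : ℂ} (hz : ‖z‖ < 1) : 0 < discWeight ξ b p z :=
  mul_pos (rpow_pos_of_pos (one_sub_norm_sq_pos hz) _)
    (Finset.prod_pos fun j _ => rpow_pos_of_pos (norm_sub_pos_of_lt hz (hξ j)) _)

lemma half_le_norm_one_sub {w z : ℂ} (hw : ‖w‖ < 1) (hz : ‖z‖ ≤ 1 / 2) :
    1 / 2 ≤ ‖1 - conj w * z‖ := by
  have h1 := norm_sub_norm_le 1 (conj w * z)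
  rw [norm_one, norm_mul, RCLike.norm_conj] at h1
  nlinarith [norm_nonneg w, norm_nonneg z]

lemma norm_mob_sub_le {w z : ℂ} (hw : ‖w‖ < 1) (hz : ‖z‖ ≤ 1 / 2) :
    ‖mob w z - w‖ ≤ 1 - ‖w‖ ^ 2 := by
  have h0 := one_sub_conj_mul_ne_zero hw (hz.trans (by norm_num))
  have h1 : mob w z - w = z * (conj w * w - 1) / (1 - conj w * z) := by
    rw [mob, eq_div_iff h0, sub_mul, div_mul_cancel₀ _ h0]
    ring
  have h2 := half_le_norm_one_sub hw hz
  rw [h1, norm_div, norm_mul, conj_mul_self_sub_one, abs_of_pos (one_sub_norm_sq_pos hw),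
    div_le_iff₀ (by linarith)]
  nlinarith [one_sub_norm_sq_pos hw]

/-- For `|z| ≤ 1/2` the denominator `|1 - w̄z|` is at least `1/2`, whence the factor 4. The point
moves by at most `1 - |w|² ≤ 2(1 - |w|) ≤ 2|w - ξ_j|`, whence the factor 3. -/
lemma discWeight_mob_le (hξ : ∀ j, ‖ξ j‖ = 1) (hb : ∀ j, 0 ≤ b j) (hp : 0 ≤ p) {w z : ℂ}
    (hw : ‖w‖ < 1) (hz : ‖z‖ ≤ 1 / 2) :
    discWeight ξ b p (mob w z) ≤ (4 ^ p * ∏ j, (3 : ℝ) ^ b j) * discWeight ξ b p w := by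
  have hw' := one_sub_norm_sq_pos hw
  have hz1 : ‖z‖ < 1 := by linarith
  have hm := one_sub_norm_sq_pos (norm_mob_lt_one hw hz1)
  have h1 : 1 - ‖mob w z‖ ^ 2 ≤ 4 * (1 - ‖w‖ ^ 2) := by
    have h2 := half_le_norm_one_sub hw hz
    rw [one_sub_norm_mob_sq hw hz1.le, div_le_iff₀ (by positivity)]
    have h3 : 1 / 4 ≤ ‖1 - conj w * z‖ ^ 2 := by nlinarith
    nlinarith [norm_nonneg z, sq_nonneg ‖z‖]
  have h2 : ∀ j, ‖mob w z - ξ j‖ ≤ 3 * ‖w - ξ j‖ := fun j => by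
    have h3 := norm_mob_sub_le hw hz
    have h4 := one_sub_norm_le (z := w) (hξ j)
    have h5 : mob w z - ξ j = (mob w z - w) + (w - ξ j) := by ring
    rw [h5]
    refine (norm_add_le _ _).trans ?_
    nlinarith [norm_nonneg w]
  have h6 : ∏ j, ‖mob w z - ξ j‖ ^ b j ≤ (∏ j, (3 : ℝ) ^ b j) * ∏ j, ‖w - ξ j‖ ^ b j := by
    rw [← Finset.prod_mul_distrib]
    refine Finset.prod_le_prod (fun j _ => by positivity) fun j _ => ?_
    rw [← Real.mul_rpow (by norm_num) (norm_nonneg _)]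
    exact Real.rpow_le_rpow (norm_nonneg _) (h2 j) (hb j)
  have h7 : (1 - ‖mob w z‖ ^ 2) ^ p ≤ 4 ^ p * (1 - ‖w‖ ^ 2) ^ p := by
    rw [← Real.mul_rpow (by norm_num) hw'.le]
    exact Real.rpow_le_rpow hm.le h1 hp
  calc discWeight ξ b p (mob w z) ≤ (4 ^ p * (1 - ‖w‖ ^ 2) ^ p) *
        ((∏ j, (3 : ℝ) ^ b j) * ∏ j, ‖w - ξ j‖ ^ b j) := by
        unfold discWeight
        gcongr
    _ = _ := by
        unfold discWeight
        ring

/-- Harnack-type comparison of the weight at points of bounded hyperbolic distance. -/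
lemma discWeight_le_of_norm_mob_le (hξ : ∀ j, ‖ξ j‖ = 1) (hb : ∀ j, 0 ≤ b j) (hp : 0 ≤ p)
    {w v : ℂ} (hw : ‖w‖ < 1) (hv : ‖v‖ < 1) (h : ‖mob w v‖ ≤ 1 / 2) :
    discWeight ξ b p v ≤ (4 ^ p * ∏ j, (3 : ℝ) ^ b j) * discWeight ξ b p w := by
  have := discWeight_mob_le hξ hb hp hw h
  rwa [mob_mob hw hv] at this

end Weight

/-! ### The sub-mean value property of the weight near the boundary. -/

section Weight

variable {N : ℕ} {ξ : Fin N → ℂ} {b : Fin N → ℝ} {p : ℝ}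

/-- A holomorphic logarithm of the square root of the pulled back weight. -/
noncomputable def logPullback (ξ : Fin N → ℂ) (b : Fin N → ℝ) (p : ℝ) (w z : ℂ) : ℂ :=
  ((p / 2 * Real.log (1 - ‖w‖ ^ 2) : ℝ) : ℂ) - p * log (1 - conj w * z) +
    ∑ j, ((b j / 2 : ℝ) : ℂ) * log (1 - conj (ξ j) * mob w z)

lemma one_sub_mem_slitPlane {a : ℂ} (ha : ‖a‖ < 1) : 1 - a ∈ slitPlane := by
  left
  have := (abs_lt.1 (lt_of_le_of_lt (abs_re_le_norm a) ha)).2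
  simpa using this

lemma one_sub_conj_mul_mem_slitPlane {w z : ℂ} (hw : ‖w‖ ≤ 1) (hz : ‖z‖ < 1) :
    1 - conj w * z ∈ slitPlane := by
  refine one_sub_mem_slitPlane ?_
  rw [norm_mul, RCLike.norm_conj]
  nlinarith [norm_nonneg w, norm_nonneg z]

lemma hasDerivAt_logPullback (hξ : ∀ j, ‖ξ j‖ = 1) {w z : ℂ} (hw : ‖w‖ < 1) (hz : ‖z‖ < 1) :
    HasDerivAt (logPullback ξ b p w)
      (p * (conj w / (1 - conj w * z)) + ∑ j, ((b j / 2 : ℝ) : ℂ) *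
        (-(conj (ξ j) * ((conj w * w - 1) / (1 - conj w * z) ^ 2)) /
          (1 - conj (ξ j) * mob w z))) z := by
  have h1 : HasDerivAt (fun z => 1 - conj w * z) (-conj w) z := by
    simpa using ((hasDerivAt_id z).const_mul (conj w)).const_sub 1
  have h2 := (h1.clog (one_sub_conj_mul_mem_slitPlane hw.le hz)).const_mul (p : ℂ)
  have h3 : ∀ j ∈ Finset.univ, HasDerivAt
      (fun z => ((b j / 2 : ℝ) : ℂ) * log (1 - conj (ξ j) * mob w z))
      (((b j / 2 : ℝ) : ℂ) * (-(conj (ξ j) * ((conj w * w - 1) / (1 - conj w * z) ^ 2)) /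
          (1 - conj (ξ j) * mob w z))) z := fun j _ =>
    ((((hasDerivAt_mob hw hz.le).const_mul (conj (ξ j))).const_sub 1).clog
      (one_sub_conj_mul_mem_slitPlane (hξ j).le (norm_mob_lt_one hw hz))).const_mul _
  have h4 := (h2.const_sub ((p / 2 * Real.log (1 - ‖w‖ ^ 2) : ℝ) : ℂ)).add (HasDerivAt.fun_sum h3)
  have h5 : (p : ℂ) * (conj w / (1 - conj w * z)) = -(p * (-conj w / (1 - conj w * z))) := by ring
  rw [h5]
  exact h4

lemma norm_sub_eq_norm_one_sub_conj_mul {a : ℂ} (ha : ‖a‖ = 1) (z : ℂ) :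
    ‖z - a‖ = ‖1 - conj a * z‖ := by
  have h : conj a * (a - z) = 1 - conj a * z := by
    rw [mul_sub, conj_mul', ha]
    simp
  rw [← h, norm_mul, RCLike.norm_conj, ha, one_mul, norm_sub_rev]

/-- The pullback is a radial factor times the squared modulus of a holomorphic function: circle
averages of the weight thus reduce to Parseval. -/
lemma discWeight_mob_eq (hξ : ∀ j, ‖ξ j‖ = 1) {w z : ℂ} (hw : ‖w‖ < 1) (hz : ‖z‖ < 1) :
    discWeight ξ b p (mob w z) = (1 - ‖z‖ ^ 2) ^ p * ‖exp (logPullback ξ b p w z)‖ ^ 2 := by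
  have h1 := one_sub_norm_sq_pos hw
  have h2 := one_sub_norm_sq_pos hz
  have h3 : 0 < ‖1 - conj w * z‖ := norm_pos_iff.2 (one_sub_conj_mul_ne_zero hw hz.le)
  rw [discWeight, one_sub_norm_mob_sq hw hz.le, norm_exp, ← Real.exp_nat_mul, mul_comm (1 - ‖w‖ ^ 2),
    mul_div_assoc, Real.mul_rpow h2.le (by positivity), mul_assoc]
  congr 1
  have h4 : ∀ j, ‖mob w z - ξ j‖ ^ b j =
      Real.exp (b j * Real.log ‖1 - conj (ξ j) * mob w z‖) := fun j => by
    rw [Real.rpow_def_of_pos (norm_sub_pos_of_lt (norm_mob_lt_one hw hz) (hξ j)),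
      norm_sub_eq_norm_one_sub_conj_mul (hξ j), mul_comm]
  rw [Finset.prod_congr rfl fun j _ => h4 j, ← Real.exp_sum, Real.rpow_def_of_pos (by positivity),
    ← Real.exp_add, Real.log_div h1.ne' (by positivity), Real.log_pow]
  congr 1
  simp only [logPullback, add_re, sub_re, re_sum, re_ofReal_mul, ofReal_re, log_re]
  rw [mul_add, Finset.mul_sum]
  push_cast
  congr 1
  · ring
  · exact Finset.sum_congr rfl fun j _ => by ring

/-- The map `a ↦ a / (1 - a)` sends the disc onto the half-plane `Re > -1/2`. -/
lemma neg_half_le_re_div {a : ℂ} (ha : ‖a‖ < 1) : -(1 / 2) ≤ (a / (1 - a)).re := by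
  have h0 : 0 < normSq (1 - a) := by
    rw [normSq_pos, sub_ne_zero]
    rintro rfl
    simp at ha
  have h1 : normSq a < 1 := by
    rw [normSq_eq_norm_sq]
    nlinarith [norm_nonneg a]
  rw [div_re, ← add_div, le_div_iff₀ h0]
  simp only [normSq_apply, sub_re, sub_im, one_re, one_im] at *
  nlinarith

/-- Since `|w| < 1`, the norm of the derivative `L` dominates `Re (w L)`. This is `p|w|²` plus one
term per `ξ_j`, each at least `-(b_j/4)(1 - |w|²)` by the half-plane bound. So the derivative is
nearly `p` or larger at the boundary, and its square then beats the loss `p` from the radial factor,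
as `p² > p`. -/
lemma le_norm_deriv_logPullback (hξ : ∀ j, ‖ξ j‖ = 1) (hb : ∀ j, 0 ≤ b j) {w : ℂ}
    (hw : ‖w‖ < 1) :
    p - (1 - ‖w‖ ^ 2) * (p + (∑ j, b j) / 4) ≤ ‖deriv (logPullback ξ b p w) 0‖ := by
  have h1 := one_sub_norm_sq_pos hw
  rw [(hasDerivAt_logPullback hξ hw (by simp : ‖(0 : ℂ)‖ < 1)).deriv]
  simp only [mul_zero, sub_zero, one_pow, div_one, mob_zero]
  set L : ℂ := p * conj w + ∑ j, ((b j / 2 : ℝ) : ℂ) *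
        (-(conj (ξ j) * (conj w * w - 1)) / (1 - conj (ξ j) * w)) with hL
  have h2 : (w * L).re ≤ ‖L‖ := by
    refine (re_le_norm _).trans ?_
    rw [norm_mul]
    nlinarith [norm_nonneg L]
  refine le_trans ?_ h2
  have h3 : w * L = ((p * ‖w‖ ^ 2 : ℝ) : ℂ) + ∑ j, ((b j / 2 * (1 - ‖w‖ ^ 2) : ℝ) : ℂ) *
      ((conj (ξ j) * w) / (1 - conj (ξ j) * w)) := by
    rw [hL, mul_add, Finset.mul_sum, conj_mul']
    congr 1
    · push_cast
      rw [← conj_mul']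
      ring
    · refine Finset.sum_congr rfl fun j _ => ?_
      push_cast
      ring
  rw [h3, add_re, re_sum, ofReal_re]
  have h4 : ∀ j ∈ Finset.univ, -(b j / 4 * (1 - ‖w‖ ^ 2)) ≤ (((b j / 2 * (1 - ‖w‖ ^ 2) : ℝ) : ℂ) *
      ((conj (ξ j) * w) / (1 - conj (ξ j) * w))).re := fun j _ => by
    rw [re_ofReal_mul]
    have h5 := neg_half_le_re_div (a := conj (ξ j) * w) (by simpa [hξ j] using hw)
    have h6 : 0 ≤ b j / 2 * (1 - ‖w‖ ^ 2) := mul_nonneg (by linarith [hb j]) h1.le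
    nlinarith
  have h7 := Finset.sum_le_sum h4
  rw [Finset.sum_neg_distrib, ← Finset.sum_mul, ← Finset.sum_div] at h7
  nlinarith

/-- Near the boundary the weight satisfies the sub-mean value property on small hyperbolic
circles. -/
lemma exists_discWeight_le_circleAverage (hξ : ∀ j, ‖ξ j‖ = 1) (hb : ∀ j, 0 ≤ b j) (hp : 1 < p) :
    ∃ a ρ : ℝ, 0 < a ∧ a < 1 ∧ 0 < ρ ∧ ρ ≤ 1 / 2 ∧ ∀ w : ℂ, ‖w‖ < 1 → 1 - ‖w‖ ^ 2 ≤ a →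
      ∀ r, 0 < r → r ≤ ρ →
        discWeight ξ b p w ≤ circleAverage (fun z => discWeight ξ b p (mob w z)) 0 r := by
  have hB : 0 ≤ ∑ j, b j := Finset.sum_nonneg fun j _ => hb j
  set B := ∑ j, b j
  -- With `1 - |w|² ≤ a` the derivative is at least `p - (p - 1)/4`, so its square is at least `q`,
  -- the midpoint of `p` and `p²`. The choice of `ρ` gives `p q r² ≤ q - p` for `r ≤ ρ`.
  set a := (p - 1) / (4 * (p + B / 4)) with ha
  set q := (p ^ 2 + p) / 2 with hq
  have hden : 0 < 4 * (p + B / 4) := by linarith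
  have hq0 : 0 < q := by positivity
  have hqp : 0 < (q - p) / (p * q) := div_pos (by rw [hq]; nlinarith) (by positivity)
  set ρ := min (1 / 2) (√((q - p) / (p * q))) with hρ
  have hρ0 : 0 < ρ := lt_min (by norm_num) (Real.sqrt_pos.2 hqp)
  refine ⟨a, ρ, div_pos (by linarith) hden, (div_lt_one hden).2 (by linarith), hρ0, min_le_left _ _,
    fun w hw hwa r hr hrρ => ?_⟩
  have hr2 : r ≤ 1 / 2 := hrρ.trans (min_le_left _ _)
  have hr1 : r < 1 := by linarith
  set f : ℂ → ℂ := fun z => exp (logPullback ξ b p w z) with hf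
  have hfd : DifferentiableOn ℂ f (ball 0 1) := fun z hz =>
    ((hasDerivAt_logPullback hξ hw (by simpa using hz)).cexp).differentiableAt.differentiableWithinAt
  have hderiv : ‖deriv f 0‖ = ‖f 0‖ * ‖deriv (logPullback ξ b p w) 0‖ := by
    have h0 := hasDerivAt_logPullback (b := b) (p := p) hξ hw (by simp : ‖(0 : ℂ)‖ < 1)
    rw [h0.deriv, ← norm_mul]
    exact congrArg norm h0.cexp.deriv
  have hq1 : q ≤ ‖deriv (logPullback ξ b p w) 0‖ ^ 2 := by
    have h1 := le_norm_deriv_logPullback (p := p) hξ hb hw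
    have h2 : (1 - ‖w‖ ^ 2) * (p + B / 4) ≤ (p - 1) / 4 := by
      have : a * (p + B / 4) = (p - 1) / 4 := by
        rw [ha]
        field_simp
      rw [← this]
      gcongr
    nlinarith [sq_nonneg (‖deriv (logPullback ξ b p w) 0‖ - p)]
  have hmean := le_circleAverage_norm_sq hfd hr hr1
  have hcongr : EqOn (fun z => discWeight ξ b p (mob w z)) (fun z => (1 - r ^ 2) ^ p * ‖f z‖ ^ 2)
      (sphere 0 |r|) := by
    intro z hz
    have hz' : ‖z‖ = r := by simpa [abs_of_pos hr] using hz
    simp only [hf]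
    rw [discWeight_mob_eq hξ hw (by rw [hz']; exact hr1), hz']
  have e := circleAverage_fun_smul (a := (1 - r ^ 2) ^ p) (f := fun z => ‖f z‖ ^ 2) (c := 0) (R := r)
  simp only [smul_eq_mul] at e
  rw [circleAverage_congr_sphere hcongr, e]
  have hw0 : discWeight ξ b p w = ‖f 0‖ ^ 2 := by
    have := discWeight_mob_eq (b := b) (p := p) hξ hw (by simp : ‖(0 : ℂ)‖ < 1)
    simpa using this
  -- Bernoulli's inequality, valid as `p > 1`.
  have hbern : 1 - p * r ^ 2 ≤ (1 - r ^ 2) ^ p := by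
    have := one_add_mul_self_le_rpow_one_add (s := -r ^ 2) (by nlinarith) hp.le
    simpa [sub_eq_add_neg] using this
  have hs : r ^ 2 * (p * q) ≤ q - p := by
    rw [← le_div_iff₀ (by positivity), ← Real.le_sqrt hr.le hqp.le]
    exact hrρ.trans (min_le_right _ _)
  -- Indeed `(1 - p r²)(1 + q r²) = 1 + r² (q - p - p q r²) ≥ 1`.
  have h1 : 1 ≤ (1 - r ^ 2) ^ p * (1 + r ^ 2 * q) := by
    have h2 : (1 - p * r ^ 2) * (1 + r ^ 2 * q) ≤ (1 - r ^ 2) ^ p * (1 + r ^ 2 * q) := by gcongr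
    nlinarith [sq_nonneg r, mul_nonneg (sq_nonneg r) (sub_nonneg.2 hs)]
  have h3 : ‖f 0‖ ^ 2 * (1 + r ^ 2 * q) ≤ circleAverage (fun z => ‖f z‖ ^ 2) 0 r := by
    refine le_trans ?_ hmean
    rw [hderiv, mul_pow]
    nlinarith [mul_le_mul_of_nonneg_left hq1 (mul_nonneg (sq_nonneg r) (sq_nonneg ‖f 0‖))]
  have h4 : 0 ≤ (1 - r ^ 2) ^ p := Real.rpow_nonneg (by nlinarith) _
  rw [hw0]
  nlinarith [mul_le_mul_of_nonneg_left h3 h4, mul_le_mul_of_nonneg_left h1 (sq_nonneg ‖f 0‖)]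

end Weight

/-! ### Hyperbolic means and their self-adjointness. -/

lemma continuousOn_aestronglyMeasurable_hypArea {f : ℂ → ℂ} (hf : ContinuousOn f unitDisc) :
    AEStronglyMeasurable f hypArea :=
  (hf.aestronglyMeasurable measurableSet_ball).mono_ac (withDensity_absolutelyContinuous _ _)

lemma integrable_hypArea_iff {g : ℂ → ℝ} :
    Integrable g hypArea ↔ IntegrableOn (fun z => g z * ((1 - ‖z‖ ^ 2) ^ 2)⁻¹) unitDisc := by
  rw [hypArea, integrable_withDensity_iff measurable_hypDensity (by simp), IntegrableOn]
  refine integrable_congr (Filter.Eventually.of_forall fun z => ?_)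
  simp only
  rw [ENNReal.toReal_ofReal (by positivity)]

lemma hypArea_ball_lt_top {ρ : ℝ} (hρ : ρ < 1) : hypArea (ball 0 ρ) < ⊤ := by
  rw [hypArea, withDensity_apply _ measurableSet_ball]
  calc ∫⁻ z in ball 0 ρ, ENNReal.ofReal ((1 - ‖z‖ ^ 2) ^ 2)⁻¹ ∂volume.restrict unitDisc
      ≤ ∫⁻ z in ball 0 ρ, ENNReal.ofReal ((1 - ρ ^ 2) ^ 2)⁻¹ ∂volume.restrict unitDisc := by
        refine setLIntegral_mono measurable_const fun z hz => ENNReal.ofReal_le_ofReal ?_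
        have hz' : ‖z‖ < ρ := by simpa using hz
        have h0 := norm_nonneg z
        have h1 : 0 < 1 - ρ ^ 2 := by nlinarith
        gcongr
    _ < ⊤ := by
        rw [setLIntegral_const]
        refine ENNReal.mul_lt_top ENNReal.ofReal_lt_top ?_
        exact (Measure.restrict_apply_le _ _).trans_lt measure_ball_lt_top

lemma hypArea_pos_of_isOpen {U : Set ℂ} (hU : IsOpen U) (hne : U.Nonempty) (hsub : U ⊆ unitDisc) :
    0 < hypArea U := by
  rw [pos_iff_ne_zero, hypArea, Ne, withDensity_apply_eq_zero measurable_hypDensity,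
    Measure.restrict_apply' measurableSet_ball]
  intro h
  have h2 : U ⊆ {z : ℂ | ENNReal.ofReal ((1 - ‖z‖ ^ 2) ^ 2)⁻¹ ≠ 0} ∩ U ∩ unitDisc := by
    intro z hz
    refine ⟨⟨?_, hz⟩, hsub hz⟩
    have := one_sub_norm_sq_pos (mem_unitDisc.1 (hsub hz))
    simp only [mem_ofPred_eq, ne_eq, ENNReal.ofReal_eq_zero, not_le]
    positivity
  exact (hU.measure_pos volume hne).ne' (measure_mono_null h2 h)

/-- The (unnormalized) mean over the hyperbolic disc around `w`. -/
noncomputable def hypMean (ρ : ℝ) (f : ℂ → ℝ) (w : ℂ) : ℝ :=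
  ∫ z in ball 0 ρ, f (mob w z) ∂hypArea

lemma measurableSet_norm_mob_lt (ρ : ℝ) : MeasurableSet {x : ℂ × ℂ | ‖mob x.1 x.2‖ < ρ} :=
  measurableSet_lt measurable_mob.norm measurable_const

lemma measurableSet_hypBall (ρ : ℝ) (w : ℂ) : MeasurableSet {v : ℂ | ‖mob w v‖ < ρ} :=
  measurableSet_lt (measurable_mob.comp (by fun_prop : Measurable fun z => (w, z))).norm
    measurable_const

section

variable {ρ : ℝ} {f : ℂ → ℝ} {w : ℂ}

lemma indicator_hypBall_comp_mob (hw : ‖w‖ < 1) (f : ℂ → ℝ) (ρ : ℝ) :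
    (fun z => {v | ‖mob w v‖ < ρ}.indicator f (mob w z)) =ᵐ[hypArea]
      (ball 0 ρ).indicator fun z => f (mob w z) := by
  filter_upwards [ae_hypArea_mem] with z hz
  by_cases h : ‖z‖ < ρ
  · rw [indicator_of_mem, indicator_of_mem] <;> simp [h, mob_mob hw hz]
  · rw [indicator_of_notMem, indicator_of_notMem] <;> simpa [mob_mob hw hz] using h

/-- Invariance of hyperbolic area moves the mean to a genuine disc around `w`, the form to which
Fubini's theorem applies. -/
lemma hypMean_eq_setIntegral (hw : ‖w‖ < 1) (hf : AEStronglyMeasurable f hypArea) :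
    hypMean ρ f w = ∫ v in {v | ‖mob w v‖ < ρ}, f v ∂hypArea := by
  have hm := measurePreserving_mob hw
  rw [hypMean, ← integral_indicator measurableSet_ball,
    ← integral_indicator (measurableSet_hypBall ρ w),
    ← integral_congr_ae (indicator_hypBall_comp_mob hw f ρ)]
  have := integral_map (μ := hypArea) hm.measurable.aemeasurable
    (f := {v | ‖mob w v‖ < ρ}.indicator f)
    (by rw [hm.map_eq]; exact hf.indicator (measurableSet_hypBall ρ w))
  rw [← this, hm.map_eq]

lemma integrableOn_comp_mob_iff (hw : ‖w‖ < 1) (hf : AEStronglyMeasurable f hypArea) :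
    IntegrableOn (fun z => f (mob w z)) (ball 0 ρ) hypArea ↔
      IntegrableOn f {v | ‖mob w v‖ < ρ} hypArea := by
  have hm := measurePreserving_mob hw
  rw [← integrable_indicator_iff measurableSet_ball,
    ← integrable_indicator_iff (measurableSet_hypBall ρ w),
    ← integrable_congr (indicator_hypBall_comp_mob hw f ρ)]
  have h := hm.integrable_comp (g := {v | ‖mob w v‖ < ρ}.indicator f)
    (hf.indicator (measurableSet_hypBall ρ w))
  rw [Function.comp_def] at h
  exact h

lemma hypArea_hypBall (hw : ‖w‖ < 1) (ρ : ℝ) :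
    hypArea {v | ‖mob w v‖ < ρ} = hypArea (ball 0 ρ) := by
  rw [← (measurePreserving_mob hw).measure_preimage
    (measurableSet_hypBall ρ w).nullMeasurableSet]
  refine measure_congr ?_
  filter_upwards [ae_hypArea_mem] with z hz
  change (‖mob w (mob w z)‖ < ρ) = (z ∈ ball (0 : ℂ) ρ)
  simp [mob_mob hw hz]

end

/-- Hyperbolic means are self-adjoint with respect to hyperbolic area. -/
lemma integral_mul_hypMean_comm {ρ C : ℝ} (hρ : ρ ≤ 1 / 2) {φ u : ℂ → ℝ} (hφ : Measurable φ)
    (hφ0 : ∀ z, ‖z‖ < 1 → 0 ≤ φ z)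
    (hC : ∀ w v, ‖w‖ < 1 → ‖v‖ < 1 → ‖mob w v‖ ≤ 1 / 2 → φ v ≤ C * φ w)
    (hu : AEStronglyMeasurable u hypArea) (hint : Integrable (fun z => u z * φ z) hypArea) :
    Integrable (fun w => φ w * hypMean ρ u w) hypArea ∧
      Integrable (fun v => u v * hypMean ρ φ v) hypArea ∧
      ∫ w, φ w * hypMean ρ u w ∂hypArea = ∫ v, u v * hypMean ρ φ v ∂hypArea := by
  set E : Set (ℂ × ℂ) := {x | ‖mob x.1 x.2‖ < ρ} with hE
  have hEm : MeasurableSet E := measurableSet_norm_mob_lt ρ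
  -- Both sides are iterated integrals of this one kernel; `hrow` and `hcol` are its two sections,
  -- related by the symmetry of the distance.
  set K : ℂ × ℂ → ℝ := E.indicator fun x => φ x.1 * u x.2 with hK
  have hKm : AEStronglyMeasurable K (hypArea.prod hypArea) :=
    ((hφ.comp measurable_fst).aestronglyMeasurable.mul hu.comp_snd).indicator hEm
  have hrow : ∀ w v, K (w, v) = φ w * {v | ‖mob w v‖ < ρ}.indicator u v := fun w v => by
    by_cases h : ‖mob w v‖ < ρ
    · rw [hK, indicator_of_mem (show (w, v) ∈ E from h),
        indicator_of_mem (show v ∈ {v | ‖mob w v‖ < ρ} from h)]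
    · rw [hK, indicator_of_notMem (show (w, v) ∉ E from h),
        indicator_of_notMem (show v ∉ {v | ‖mob w v‖ < ρ} from h), mul_zero]
  have hcol : ∀ w v, K (w, v) = u v * {w | ‖mob v w‖ < ρ}.indicator φ w := fun w v => by
    by_cases h : ‖mob w v‖ < ρ
    · rw [hK, indicator_of_mem (show (w, v) ∈ E from h),
        indicator_of_mem (show w ∈ {w | ‖mob v w‖ < ρ} by rwa [mem_ofPred_eq, norm_mob_comm]),
        mul_comm]
    · rw [hK, indicator_of_notMem (show (w, v) ∉ E from h),
        indicator_of_notMem (show w ∉ {w | ‖mob v w‖ < ρ} by rwa [mem_ofPred_eq, norm_mob_comm]),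
        mul_zero]
  have hbound : ∀ v, ‖v‖ < 1 → ∀ᵐ w ∂hypArea,
      ‖{w | ‖mob v w‖ < ρ}.indicator φ w‖ ≤ {w | ‖mob v w‖ < ρ}.indicator (fun _ => C * φ v) w := by
    intro v hv
    filter_upwards [ae_hypArea_mem] with w hw
    by_cases h : ‖mob v w‖ < ρ
    · rw [indicator_of_mem (show w ∈ {w | ‖mob v w‖ < ρ} from h), indicator_of_mem
        (show w ∈ {w | ‖mob v w‖ < ρ} from h), Real.norm_eq_abs, abs_of_nonneg (hφ0 w hw)]
      exact hC v w hv hw (h.le.trans hρ)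
    · rw [indicator_of_notMem (show w ∉ {w | ‖mob v w‖ < ρ} from h), indicator_of_notMem
        (show w ∉ {w | ‖mob v w‖ < ρ} from h), norm_zero]
  have hdom : ∀ v, ‖v‖ < 1 →
      Integrable ({w | ‖mob v w‖ < ρ}.indicator fun _ => C * φ v) hypArea := fun v hv => by
    rw [integrable_indicator_iff (measurableSet_hypBall ρ v), integrableOn_const_iff]
    right
    rw [hypArea_hypBall hv]
    exact hypArea_ball_lt_top (by linarith)
  have hφi : ∀ v, ‖v‖ < 1 → Integrable ({w | ‖mob v w‖ < ρ}.indicator φ) hypArea := fun v hv =>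
    (hdom v hv).mono' (hφ.indicator (measurableSet_hypBall ρ v)).aestronglyMeasurable (hbound v hv)
  have hKi : Integrable K (hypArea.prod hypArea) := by
    rw [integrable_prod_iff' hKm]
    constructor
    · filter_upwards [ae_hypArea_mem] with v hv
      simp only [hcol]
      exact (hφi v hv).const_mul _
    -- The comparison `hC` bounds the integral of `φ` over the disc around `v` by a multiple of `φ
    -- v`, so integrability of `u φ` suffices.
    · refine (hint.norm.const_mul (C * hypArea.real (ball 0 ρ))).mono'
        hKm.norm.prod_swap.integral_prod_right' ?_
      filter_upwards [ae_hypArea_mem] with v hv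
      rw [Real.norm_eq_abs, abs_of_nonneg (integral_nonneg fun _ => norm_nonneg _)]
      simp only [hcol, norm_mul, integral_const_mul]
      have h1 := integral_mono_ae (hφi v hv).norm (hdom v hv) (hbound v hv)
      rw [integral_indicator_const _ (measurableSet_hypBall ρ v), smul_eq_mul, Measure.real,
        hypArea_hypBall hv] at h1
      rw [Real.norm_eq_abs (φ v), abs_of_nonneg (hφ0 v hv), Measure.real]
      calc ‖u v‖ * _ ≤ ‖u v‖ * _ := mul_le_mul_of_nonneg_left h1 (norm_nonneg _)
        _ = _ := by ring
  have e1 : (fun w => ∫ v, K (w, v) ∂hypArea) =ᵐ[hypArea] fun w => φ w * hypMean ρ u w := by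
    filter_upwards [ae_hypArea_mem] with w hw
    simp only [hrow, integral_const_mul]
    rw [integral_indicator (measurableSet_hypBall ρ w), hypMean_eq_setIntegral hw hu]
  have e2 : (fun v => ∫ w, K (w, v) ∂hypArea) =ᵐ[hypArea] fun v => u v * hypMean ρ φ v := by
    filter_upwards [ae_hypArea_mem] with v hv
    simp only [hcol, integral_const_mul]
    rw [integral_indicator (measurableSet_hypBall ρ v),
      hypMean_eq_setIntegral hv hφ.aestronglyMeasurable]
  refine ⟨hKi.integral_prod_left.congr e1, hKi.integral_prod_right.congr e2, ?_⟩
  rw [← integral_congr_ae e1, ← integral_congr_ae e2]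
  exact integral_integral_swap (f := fun w v => K (w, v)) hKi

/-! ### Integrability of powers of the distance to the boundary and of the weight. -/

lemma integrableOn_one_sub_norm_rpow {s : ℝ} (hs : -1 < s) :
    IntegrableOn (fun z : ℂ => (1 - ‖z‖) ^ s) unitDisc := by
  rw [unitDisc, integrableOn_fun_norm_addHaar volume (f := fun y => (1 - y) ^ s)]
  have h1 : IntervalIntegrable (fun y : ℝ => (1 - y) ^ s) volume 0 1 := by
    have := (intervalIntegral.intervalIntegrable_rpow' (a := 0) (b := 1) hs).comp_sub_left 1
    simpa using this.symm
  rw [intervalIntegrable_iff_integrableOn_Ioo_of_le zero_le_one] at h1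
  refine h1.mono' (by fun_prop) ?_
  filter_upwards [ae_restrict_mem measurableSet_Ioo] with y hy
  have h2 : 0 ≤ (1 - y) ^ s := Real.rpow_nonneg (by linarith [hy.2]) _
  simp only [finrank_real_complex, smul_eq_mul, Real.norm_eq_abs, Nat.reduceSub, pow_one]
  rw [abs_of_nonneg (mul_nonneg hy.1.le h2)]
  nlinarith [hy.2]

/-- The factor `1 + |z|` lies in `[1, 2]`; the maximum covers negative exponents. -/
lemma one_sub_norm_sq_rpow_le {z : ℂ} (hz : ‖z‖ < 1) (s : ℝ) :
    (1 - ‖z‖ ^ 2) ^ s ≤ 2 ^ max s 0 * (1 - ‖z‖) ^ s := by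
  have h1 : 1 - ‖z‖ ^ 2 = (1 + ‖z‖) * (1 - ‖z‖) := by ring
  have h0 := norm_nonneg z
  rw [h1, Real.mul_rpow (by positivity) (by linarith)]
  refine mul_le_mul_of_nonneg_right ?_ (Real.rpow_nonneg (by linarith) _)
  exact (Real.rpow_le_rpow_of_exponent_le (by linarith) (le_max_left s 0)).trans
    (Real.rpow_le_rpow (by positivity) (by linarith) (le_max_right s 0))

lemma integrable_one_sub_norm_sq_rpow {p : ℝ} (hp : 1 < p) :
    Integrable (fun z : ℂ => (1 - ‖z‖ ^ 2) ^ p) hypArea := by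
  rw [integrable_hypArea_iff]
  refine ((integrableOn_one_sub_norm_rpow (s := p - 2) (by linarith)).const_mul
    (2 ^ max (p - 2) 0)).mono' (by fun_prop) ?_
  filter_upwards [ae_restrict_mem measurableSet_ball] with z hz
  have hz1 := mem_unitDisc.1 hz
  have h1 := one_sub_norm_sq_pos hz1
  have h2 : (1 - ‖z‖ ^ 2) ^ p * ((1 - ‖z‖ ^ 2) ^ 2)⁻¹ = (1 - ‖z‖ ^ 2) ^ (p - 2) := by
    rw [Real.rpow_sub h1, Real.rpow_two, div_eq_mul_inv]
  rw [h2, Real.norm_eq_abs, abs_of_nonneg (Real.rpow_nonneg h1.le _)]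
  exact one_sub_norm_sq_rpow_le hz1 _

section Weight

variable {N : ℕ} {ξ : Fin N → ℂ} {b : Fin N → ℝ} {p : ℝ}

lemma prod_norm_sub_rpow_le (hξ : ∀ j, ‖ξ j‖ = 1) (hb : ∀ j, 0 ≤ b j) {z : ℂ} (hz : ‖z‖ < 1) :
    ∏ j, ‖z - ξ j‖ ^ b j ≤ ∏ j, (2 : ℝ) ^ b j := by
  refine Finset.prod_le_prod (fun j _ => by positivity) fun j _ => ?_
  refine Real.rpow_le_rpow (norm_nonneg _) ?_ (hb j)
  have := norm_sub_le z (ξ j)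
  rw [hξ j] at this
  linarith

lemma discWeight_le (hξ : ∀ j, ‖ξ j‖ = 1) (hb : ∀ j, 0 ≤ b j) {z : ℂ} (hz : ‖z‖ < 1) :
    discWeight ξ b p z ≤ (∏ j, (2 : ℝ) ^ b j) * (1 - ‖z‖ ^ 2) ^ p := by
  rw [discWeight, mul_comm]
  exact mul_le_mul_of_nonneg_right (prod_norm_sub_rpow_le hξ hb hz)
    (Real.rpow_nonneg (one_sub_norm_sq_pos hz).le _)

lemma integrable_mul_discWeight (hξ : ∀ j, ‖ξ j‖ = 1) (hb : ∀ j, 0 ≤ b j) {u : ℂ → ℝ}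
    (hu : AEStronglyMeasurable u hypArea)
    (hint : Integrable (fun z => u z * (1 - ‖z‖ ^ 2) ^ p) hypArea) :
    Integrable (fun z => u z * discWeight ξ b p z) hypArea := by
  refine (hint.norm.const_mul (∏ j, (2 : ℝ) ^ b j)).mono'
    (hu.mul (measurable_discWeight ξ b p).aestronglyMeasurable) ?_
  filter_upwards [ae_hypArea_mem] with z hz
  have h1 := discWeight_le (p := p) hξ hb hz
  rw [norm_mul, norm_mul, Real.norm_eq_abs (discWeight ξ b p z), abs_of_pos (discWeight_pos hξ hz),
    Real.norm_eq_abs (_ ^ p), abs_of_nonneg (Real.rpow_nonneg (one_sub_norm_sq_pos hz).le _)]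
  nlinarith [mul_le_mul_of_nonneg_left h1 (norm_nonneg (u z))]

lemma integrable_discWeight (hξ : ∀ j, ‖ξ j‖ = 1) (hb : ∀ j, 0 ≤ b j) (hp : 1 < p) :
    Integrable (discWeight ξ b p) hypArea := by
  have := integrable_mul_discWeight (p := p) (u := fun _ => 1) hξ hb
    aestronglyMeasurable_const (by simpa using integrable_one_sub_norm_sq_rpow hp)
  simpa using this

lemma exists_le_discWeight (hξ : ∀ j, ‖ξ j‖ = 1) (hb : ∀ j, 0 ≤ b j) (hp : 0 ≤ p) {r : ℝ}
    (hr0 : 0 ≤ r) (hr : r < 1) : ∃ c > 0, ∀ z : ℂ, ‖z‖ ≤ r → c ≤ discWeight ξ b p z := by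
  have h1 : 0 < 1 - r := by linarith
  have h2 : 0 < 1 - r ^ 2 := by nlinarith
  refine ⟨(1 - r ^ 2) ^ p * ∏ j, (1 - r) ^ b j, ?_, fun z hz => ?_⟩
  · exact mul_pos (Real.rpow_pos_of_pos h2 _)
      (Finset.prod_pos fun j _ => Real.rpow_pos_of_pos h1 _)
  · have h3 : (1 - r ^ 2) ^ p ≤ (1 - ‖z‖ ^ 2) ^ p := by
      refine Real.rpow_le_rpow h2.le ?_ hp
      gcongr
    have h4 : ∏ j, (1 - r) ^ b j ≤ ∏ j, ‖z - ξ j‖ ^ b j := by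
      refine Finset.prod_le_prod (fun j _ => Real.rpow_nonneg h1.le _) fun j _ => ?_
      refine Real.rpow_le_rpow h1.le ?_ (hb j)
      linarith [one_sub_norm_le (z := z) (hξ j)]
    exact mul_le_mul h3 h4 (Finset.prod_nonneg fun j _ => Real.rpow_nonneg h1.le _)
      ((Real.rpow_nonneg h2.le _).trans h3)

end Weight

/-! ### The function `log |h|`: integrability and Jensen's formula. -/

section LogNorm

variable {h : ℂ → ℂ}

lemma circleIntegrable_log_norm (hd : DifferentiableOn ℂ h unitDisc) {r : ℝ} (hr0 : 0 ≤ r)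
    (hr : r < 1) : CircleIntegrable (fun z => Real.log ‖h z‖) 0 r := by
  refine MeromorphicOn.circleIntegrable_log_norm_of_nonneg (fun z hz => ?_) hr0
  refine ((hd.analyticOnNhd isOpen_ball) z ?_).meromorphicAt
  have : ‖z‖ = r := by simpa using hz
  exact mem_unitDisc.2 (this ▸ hr)

/-- Jensen's formula with all zeros discarded. -/
lemma circleAverage_log_norm_nonneg (hd : DifferentiableOn ℂ h unitDisc) (h0 : h 0 = 1) {r : ℝ}
    (hr0 : 0 ≤ r) (hr : r < 1) : 0 ≤ circleAverage (fun z => Real.log ‖h z‖) 0 r := by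
  rcases hr0.eq_or_lt with rfl | hr0
  · simp [h0]
  · have := sum_order_mul_log_le_circleAverage hr0
      ((hd.analyticOnNhd isOpen_ball).mono (closedBall_subset_ball hr)) (by simp [h0]) ∅ (by simp)
    simpa [h0] using this

/-- From `x ≤ M` and `M ≥ 0` follows `|x| ≤ 2M - x`, and the mean of `x` is nonnegative. -/
lemma circleAverage_abs_log_norm_le (hd : DifferentiableOn ℂ h unitDisc) (h0 : h 0 = 1) {M : ℝ}
    (hM : ∀ z, ‖z‖ < 1 → Real.log ‖h z‖ ≤ M) {r : ℝ} (hr0 : 0 ≤ r) (hr : r < 1) :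
    circleAverage (fun z => |Real.log ‖h z‖|) 0 r ≤ 2 * M := by
  have hM0 : 0 ≤ M := by simpa [h0] using hM 0 (by simp)
  have hi := circleIntegrable_log_norm hd hr0 hr
  have h1 : CircleIntegrable (fun z => 2 * M - Real.log ‖h z‖) 0 r :=
    (circleIntegrable_const _ _ _).sub hi
  have h2 := circleAverage_mono (f₁ := fun z => |Real.log ‖h z‖|) hi.abs h1 fun z hz => by
    have hz' : ‖z‖ = r := by simpa [abs_of_nonneg hr0] using hz
    have := hM z (hz' ▸ hr)
    exact abs_le.2 ⟨by linarith, by linarith⟩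
  refine h2.trans ?_
  rw [circleAverage_fun_sub (circleIntegrable_const _ _ _) hi, circleAverage_const]
  linarith [circleAverage_log_norm_nonneg hd h0 hr0 hr]

lemma aestronglyMeasurable_log_norm (hd : DifferentiableOn ℂ h unitDisc) :
    AEStronglyMeasurable (fun z => Real.log ‖h z‖) hypArea :=
  (Real.measurable_log.comp_aemeasurable
    (continuousOn_aestronglyMeasurable_hypArea hd.continuousOn).norm.aemeasurable).aestronglyMeasurable

/-- The weight is constant on circles centred at `0`, so the uniform bound on the circle means of
`|log |h||` is enough. -/
lemma integrable_log_norm_mul_rpow (hd : DifferentiableOn ℂ h unitDisc) (h0 : h 0 = 1) {M p : ℝ}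
    (hM : ∀ z, ‖z‖ < 1 → Real.log ‖h z‖ ≤ M) (hp : 1 < p) :
    Integrable (fun z => Real.log ‖h z‖ * (1 - ‖z‖ ^ 2) ^ p) hypArea := by
  have hm : Measurable fun z : ℂ => (1 - ‖z‖ ^ 2) ^ p := by fun_prop
  have hcongr : ∀ (u : ℂ → ℝ) (r : ℝ), 0 ≤ r → EqOn (fun z => u z * (1 - ‖z‖ ^ 2) ^ p)
      (fun z => (1 - r ^ 2) ^ p • u z) (sphere 0 |r|) := fun u r hr0 z hz => by
    have hz' : ‖z‖ = r := by simpa [abs_of_nonneg hr0] using hz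
    simp only [hz', smul_eq_mul, mul_comm]
  refine integrable_of_circleAverage_le rotInvariant_hypArea
    (m := fun z => 2 * M * (1 - ‖z‖ ^ 2) ^ p)
    ((aestronglyMeasurable_log_norm hd).mul hm.aestronglyMeasurable)
    ((integrable_one_sub_norm_sq_rpow hp).const_mul _) ?_ ?_
  · filter_upwards [ae_hypArea_mem] with z hz
    have h1 : CircleIntegrable (fun w => (1 - ‖z‖ ^ 2) ^ p • Real.log ‖h w‖) 0 ‖z‖ :=
      (circleIntegrable_log_norm hd (norm_nonneg z) hz).const_mul _
    refine h1.congr fun θ _ => ?_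
    exact (hcongr (fun w => Real.log ‖h w‖) ‖z‖ (norm_nonneg z) (circleMap_mem_sphere' 0 _ θ)).symm
  · filter_upwards [ae_hypArea_mem] with z hz
    have h1 := Real.rpow_nonneg (one_sub_norm_sq_pos hz).le p
    have h2 : EqOn (fun w => |Real.log ‖h w‖ * (1 - ‖w‖ ^ 2) ^ p|)
        (fun w => (1 - ‖z‖ ^ 2) ^ p • |Real.log ‖h w‖|) (sphere 0 |‖z‖|) := fun w hw => by
      have := hcongr (fun w => Real.log ‖h w‖) ‖z‖ (norm_nonneg z) hw
      simp only at this ⊢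
      rw [this, smul_eq_mul, abs_mul, abs_of_nonneg h1, smul_eq_mul]
    rw [circleAverage_congr_sphere h2, circleAverage_fun_smul, smul_eq_mul, mul_comm]
    exact mul_le_mul_of_nonneg_right
      (circleAverage_abs_log_norm_le hd h0 hM (norm_nonneg z) hz) h1

lemma ae_hypArea_ne_zero (hd : DifferentiableOn ℂ h unitDisc) (h0 : h 0 = 1) :
    ∀ᵐ z ∂hypArea, h z ≠ 0 := by
  have h1 := (hd.analyticOnNhd isOpen_ball).preimage_zero_mem_codiscreteWithin (x := 0)
    (by simp [h0]) (by simp) ((convex_ball _ _).isConnected ⟨0, by simp⟩)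
  exact (withDensity_absolutelyContinuous _ _).ae_le
    (ae_restrict_le_codiscreteWithin measurableSet_ball h1)

/-- Jensen's formula on a hyperbolic circle. -/
lemma sum_order_mul_log_le_circleAverage_mob (hd : DifferentiableOn ℂ h unitDisc) {w : ℂ}
    (hw : ‖w‖ < 1) (hw0 : h w ≠ 0) {r : ℝ} (hr0 : 0 < r) (hr : r < 1) (S : Finset ℂ)
    (hS : ∀ z ∈ S, ‖z‖ < 1 ∧ ‖mob w z‖ ≤ r) :
    ∑ z ∈ S, (analyticOrderNatAt h z : ℝ) * Real.log (r / ‖mob w z‖) + Real.log ‖h w‖ ≤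
      circleAverage (fun z => Real.log ‖h (mob w z)‖) 0 r := by
  classical
  have hmd : DifferentiableOn ℂ (mob w) unitDisc := fun z hz =>
    (hasDerivAt_mob hw (mem_unitDisc.1 hz).le).differentiableAt.differentiableWithinAt
  have hfd : DifferentiableOn ℂ (h ∘ mob w) unitDisc := hd.comp hmd fun z hz =>
    mem_unitDisc.2 (norm_mob_lt_one hw (mem_unitDisc.1 hz))
  -- Composition with a map of nonvanishing derivative preserves the order of a zero.
  have hord : ∀ z, ‖z‖ < 1 → analyticOrderNatAt (h ∘ mob w) (mob w z) = analyticOrderNatAt h z := by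
    intro z hz
    have hz' := norm_mob_lt_one hw hz
    have hderiv := hasDerivAt_mob hw hz'.le
    rw [analyticOrderNatAt, analyticOrderAt_comp_of_deriv_ne_zero
      (hmd.analyticOnNhd isOpen_ball _ (mem_unitDisc.2 hz')), mob_mob hw hz, analyticOrderNatAt]
    rw [hderiv.deriv]
    refine div_ne_zero ?_ (pow_ne_zero _ (one_sub_conj_mul_ne_zero hw hz'.le))
    rw [← norm_ne_zero_iff, conj_mul_self_sub_one]
    exact (abs_pos.2 (one_sub_norm_sq_pos hw).ne').ne'
  have hinj : InjOn (mob w) S := fun x hx y hy hxy => by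
    rw [← mob_mob hw (hS x hx).1, hxy, mob_mob hw (hS y hy).1]
  have key := sum_order_mul_log_le_circleAverage (f := h ∘ mob w) hr0
    ((hfd.analyticOnNhd isOpen_ball).mono (closedBall_subset_ball hr)) (by simpa using hw0)
    (S.image (mob w)) (by simpa using fun z hz => (hS z hz).2)
  rw [Finset.sum_image hinj, Function.comp_apply, mob_zero] at key
  refine le_trans (le_of_eq ?_) key
  congr 1
  exact Finset.sum_congr rfl fun z hz => by rw [hord z (hS z hz).1]

end LogNorm

/-! ### The zero-counting estimate for bounded functions. -/

section

variable {h : ℂ → ℂ}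

lemma setIntegral_ball_circleAverage {F : ℂ → ℝ} {ρ : ℝ}
    (hF : IntegrableOn F (ball 0 ρ) hypArea) :
    IntegrableOn (fun z => circleAverage F 0 ‖z‖) (ball 0 ρ) hypArea ∧
      ∫ z in ball 0 ρ, circleAverage F 0 ‖z‖ ∂hypArea = ∫ z in ball 0 ρ, F z ∂hypArea :=
  integral_circleAverage (rotInvariant_hypArea.restrict_ball ρ) hF

/-- The gain in the sub-mean value property of `log |h|` caused by zeros of `h`. -/
lemma add_sum_order_le_hypMean (hd : DifferentiableOn ℂ h unitDisc) {w : ℂ}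
    (hw : ‖w‖ < 1) (hw0 : h w ≠ 0) {ρ : ℝ} (hρ : ρ < 1)
    (hint : IntegrableOn (fun z => Real.log ‖h z‖) {v | ‖mob w v‖ < ρ} hypArea) (S : Finset ℂ)
    (hS : ∀ z ∈ S, ‖z‖ < 1 ∧ h z = 0) :
    hypArea.real (ball 0 ρ) * Real.log ‖h w‖ +
        Real.log 2 * hypArea.real (ball 0 ρ \ ball 0 (ρ / 2)) *
          ∑ z ∈ S, (analyticOrderNatAt h z : ℝ) * {v | ‖mob z v‖ < ρ / 4}.indicator 1 w ≤
      hypMean ρ (fun z => Real.log ‖h z‖) w := by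
  classical
  set G : ℝ := ∑ z ∈ S, (analyticOrderNatAt h z : ℝ) * {v | ‖mob z v‖ < ρ / 4}.indicator 1 w with hG
  have hG0 : 0 ≤ G := Finset.sum_nonneg fun z _ =>
    mul_nonneg (Nat.cast_nonneg _) (indicator_nonneg (fun _ _ => zero_le_one) _)
  have hG' : G = ∑ z ∈ S with ‖mob w z‖ < ρ / 4, (analyticOrderNatAt h z : ℝ) := by
    rw [hG, Finset.sum_filter]
    refine Finset.sum_congr rfl fun z _ => ?_
    by_cases hz : ‖mob w z‖ < ρ / 4
    · rw [if_pos hz, indicator_of_mem (by rwa [mem_ofPred_eq, norm_mob_comm])]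
      simp
    · rw [if_neg hz, indicator_of_notMem (by rwa [mem_ofPred_eq, norm_mob_comm]), mul_zero]
  have hfin : hypArea (ball 0 ρ) ≠ ⊤ := (hypArea_ball_lt_top hρ).ne
  obtain ⟨h1, h2⟩ := setIntegral_ball_circleAverage
    ((integrableOn_comp_mob_iff hw (aestronglyMeasurable_log_norm hd)).2 hint)
  rw [hypMean, ← h2]
  have hA : MeasurableSet (ball (0 : ℂ) ρ \ ball 0 (ρ / 2)) :=
    measurableSet_ball.diff measurableSet_ball
  have hi1 : IntegrableOn (fun _ : ℂ => Real.log ‖h w‖) (ball 0 ρ) hypArea :=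
    integrableOn_const hfin
  have hi2 : IntegrableOn ((ball (0 : ℂ) ρ \ ball 0 (ρ / 2)).indicator fun _ => Real.log 2 * G)
      (ball 0 ρ) hypArea :=
    (integrableOn_const hfin).indicator hA
  have h3 : ∫ z in ball 0 ρ, (Real.log ‖h w‖ +
      (ball (0 : ℂ) ρ \ ball 0 (ρ / 2)).indicator (fun _ => Real.log 2 * G) z) ∂hypArea =
      hypArea.real (ball 0 ρ) * Real.log ‖h w‖ +
        Real.log 2 * hypArea.real (ball 0 ρ \ ball 0 (ρ / 2)) * G := by
    rw [integral_add hi1 hi2, setIntegral_const, smul_eq_mul, setIntegral_indicator hA,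
      inter_eq_right.2 sdiff_subset, setIntegral_const, smul_eq_mul]
    ring
  rw [← h3]
  refine setIntegral_mono_on (hi1.add hi2) h1 measurableSet_ball fun z hz => ?_
  have hz1 : ‖z‖ < ρ := by simpa using hz
  rcases (norm_nonneg z).eq_or_lt with hz0 | hz0
  · rw [← hz0, circleAverage_zero, mob_zero, indicator_of_notMem, add_zero]
    have : 0 < ρ := hz0 ▸ hz1
    simp [norm_eq_zero.1 hz0.symm, this]
  -- On circles of radius below `ρ/2` only the sub-mean value inequality is used. On the outer
  -- annulus, a zero at distance less than `ρ/4` from `w` contributes at least `log 2` to Jensen's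
  -- formula.
  · by_cases hz2 : ‖z‖ < ρ / 2
    · have := sum_order_mul_log_le_circleAverage_mob hd hw hw0 hz0 (hz1.trans hρ) ∅ (by simp)
      rw [indicator_of_notMem (by simp [hz2]), add_zero]
      simpa using this
    · have := sum_order_mul_log_le_circleAverage_mob hd hw hw0 hz0 (hz1.trans hρ)
        (S.filter fun z => ‖mob w z‖ < ρ / 4) fun x hx => by
          rw [Finset.mem_filter] at hx
          exact ⟨(hS x hx.1).1, by linarith [hx.2]⟩
      rw [indicator_of_mem (by simpa [hz1] using hz2)]
      refine le_trans ?_ this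
      rw [add_comm, hG', mul_comm, Finset.sum_mul]
      gcongr with x hx
      rw [Finset.mem_filter] at hx
      have hx0 : 0 < ‖mob w x‖ := by
        rw [norm_pos_iff]
        intro hx0
        have := mob_mob hw (hS x hx.1).1
        rw [hx0, mob_zero] at this
        exact hw0 (this ▸ (hS x hx.1).2)
      rw [le_div_iff₀ hx0]
      linarith [hx.2]

/-- Here `|x| = 2x₊ - x`, and `log |h|` has nonnegative integral over centred discs. -/
lemma setIntegral_abs_log_norm_le (hd : DifferentiableOn ℂ h unitDisc) (h0 : h 0 = 1) {r : ℝ}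
    (hr : r < 1) (hint : IntegrableOn (fun z => Real.log ‖h z‖) (ball 0 r) hypArea) :
    ∫ z in ball 0 r, |Real.log ‖h z‖| ∂hypArea ≤
      2 * ∫ z in ball 0 r, max (Real.log ‖h z‖) 0 ∂hypArea := by
  have h1 : 0 ≤ ∫ z in ball 0 r, Real.log ‖h z‖ ∂hypArea := by
    rw [← (setIntegral_ball_circleAverage hint).2]
    refine setIntegral_nonneg measurableSet_ball fun z hz => ?_
    exact circleAverage_log_norm_nonneg hd h0 (norm_nonneg z)
      ((show ‖z‖ < r by simpa using hz).trans hr)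
  have h2 : ∀ x : ℝ, |x| = 2 * max x 0 - x := fun x => by
    rcases le_total 0 x with hx | hx
    · rw [abs_of_nonneg hx, max_eq_left hx]; ring
    · rw [abs_of_nonpos hx, max_eq_right hx]; ring
  simp only [h2]
  rw [integral_sub (hint.pos_part.const_mul 2) hint, integral_const_mul]
  linarith

variable {N : ℕ} {ξ : Fin N → ℂ} {b : Fin N → ℝ} {p : ℝ}

lemma le_hypMean_discWeight (hξ : ∀ j, ‖ξ j‖ = 1) (hb : ∀ j, 0 ≤ b j) (hp : 1 < p) {w : ℂ}
    (hw : ‖w‖ < 1) {ρ : ℝ} (hρ : ρ < 1)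
    (hsub : ∀ r, 0 < r → r ≤ ρ →
      discWeight ξ b p w ≤ circleAverage (fun z => discWeight ξ b p (mob w z)) 0 r) :
    hypArea.real (ball 0 ρ) * discWeight ξ b p w ≤ hypMean ρ (discWeight ξ b p) w := by
  have hfin : hypArea (ball 0 ρ) ≠ ⊤ := (hypArea_ball_lt_top hρ).ne
  obtain ⟨h1, h2⟩ := setIntegral_ball_circleAverage ((integrableOn_comp_mob_iff (ρ := ρ) hw
    (measurable_discWeight ξ b p).aestronglyMeasurable).2
      (integrable_discWeight hξ hb hp).integrableOn)
  rw [hypMean, ← h2, ← smul_eq_mul, ← setIntegral_const]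
  refine setIntegral_mono_on (integrableOn_const hfin) h1 measurableSet_ball fun z hz => ?_
  rcases (norm_nonneg z).eq_or_lt with hz0 | hz0
  · rw [← hz0, circleAverage_zero, mob_zero]
  · exact hsub _ hz0 (show ‖z‖ < ρ by simpa using hz).le

lemma hypMean_discWeight_le (hξ : ∀ j, ‖ξ j‖ = 1) (hb : ∀ j, 0 ≤ b j) (hp : 1 < p) {w : ℂ}
    (hw : ‖w‖ < 1) {ρ : ℝ} (hρ : ρ ≤ 1 / 2) :
    hypMean ρ (discWeight ξ b p) w ≤
      hypArea.real (ball 0 ρ) * ((4 ^ p * ∏ j, (3 : ℝ) ^ b j) * discWeight ξ b p w) := by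
  have hfin : hypArea (ball 0 ρ) ≠ ⊤ := (hypArea_ball_lt_top (by linarith)).ne
  rw [hypMean, ← smul_eq_mul, ← setIntegral_const]
  refine setIntegral_mono_on ((integrableOn_comp_mob_iff (ρ := ρ) hw
    (measurable_discWeight ξ b p).aestronglyMeasurable).2
      (integrable_discWeight hξ hb hp).integrableOn) (integrableOn_const hfin)
    measurableSet_ball fun z hz => ?_
  exact discWeight_mob_le hξ hb (by linarith) hw ((show ‖z‖ < ρ by simpa using hz).le.trans hρ)

lemma integrableOn_of_le_discWeight {s : Set ℂ} (hs : MeasurableSet s) {u : ℂ → ℝ} {c : ℝ}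
    (hξ : ∀ j, ‖ξ j‖ = 1) (hc : 0 < c)
    (hle : ∀ z ∈ s, ‖z‖ < 1 → c ≤ discWeight ξ b p z) (hu : AEStronglyMeasurable u hypArea)
    (hint : Integrable (fun z => u z * discWeight ξ b p z) hypArea) :
    IntegrableOn u s hypArea := by
  refine (hint.norm.const_mul c⁻¹).integrableOn.mono' hu.restrict ?_
  filter_upwards [ae_restrict_mem hs, ae_restrict_of_ae ae_hypArea_mem] with z hz hz1
  rw [norm_mul, Real.norm_eq_abs (discWeight ξ b p z), abs_of_pos (discWeight_pos hξ hz1),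
    inv_mul_eq_div, le_div_iff₀ hc]
  exact mul_le_mul_of_nonneg_left (hle z hz hz1) (norm_nonneg _)

/-- The main zero-counting estimate, for functions bounded on the disc. -/
theorem exists_sum_order_mul_discWeight_le (hξ : ∀ j, ‖ξ j‖ = 1) (hb : ∀ j, 0 ≤ b j)
    (hp : 1 < p) :
    ∃ C : ℝ, 0 < C ∧ ∀ (h : ℂ → ℂ) (M : ℝ) (S : Finset ℂ), DifferentiableOn ℂ h unitDisc →
      h 0 = 1 → (∀ z, ‖z‖ < 1 → Real.log ‖h z‖ ≤ M) → (∀ z ∈ S, ‖z‖ < 1 ∧ h z = 0) →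
      ∑ z ∈ S, (analyticOrderNatAt h z : ℝ) * discWeight ξ b p z ≤
        C * ∫ z, max (Real.log ‖h z‖) 0 * discWeight ξ b p z ∂hypArea := by
  obtain ⟨a, ρ, ha0, ha1, hρ0, hρ, hsub⟩ := exists_discWeight_le_circleAverage hξ hb hp
  have hp0 : 0 ≤ p := by linarith
  set φ := discWeight ξ b p with hφ
  set C₁ : ℝ := 4 ^ p * ∏ j, (3 : ℝ) ^ b j with hC₁
  have hC₁0 : 0 < C₁ := mul_pos (by positivity) (Finset.prod_pos fun j _ => by positivity)
  set B : ℝ := ∏ j, (2 : ℝ) ^ b j with hB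
  have hB0 : 0 < B := Finset.prod_pos fun j _ => by positivity
  set Λ := hypArea.real (ball 0 ρ) with hΛ
  have hΛ0 : 0 ≤ Λ := measureReal_nonneg
  have hfin : ∀ s ≤ ρ, hypArea (ball 0 s) < ⊤ := fun s hs => hypArea_ball_lt_top (by linarith)
  have hc₀ : 0 < hypArea.real (ball 0 ρ \ ball 0 (ρ / 2)) := by
    refine ENNReal.toReal_pos (ne_of_gt ?_)
      ((measure_mono sdiff_subset).trans_lt (hfin ρ le_rfl)).ne
    refine (hypArea_pos_of_isOpen (U := ball 0 ρ \ closedBall 0 (ρ / 2))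
      (isOpen_ball.sdiff isClosed_closedBall) ⟨((3 * ρ / 4 : ℝ) : ℂ), ?_⟩ ?_).trans_le
      (measure_mono (sdiff_subset_sdiff_right ball_subset_closedBall))
    · rw [mem_sdiff, mem_ball_zero_iff, mem_closedBall_zero_iff, norm_real, Real.norm_eq_abs,
        abs_of_pos (by positivity)]
      constructor <;> linarith
    · exact sdiff_subset.trans (ball_subset_ball (by linarith))
  set c₀ := Real.log 2 * hypArea.real (ball 0 ρ \ ball 0 (ρ / 2)) with hc₀'
  have hc₀0 : 0 < c₀ := mul_pos (Real.log_pos (by norm_num)) hc₀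
  set c₁ := hypArea.real (ball 0 (ρ / 4)) with hc₁
  have hc₁0 : 0 < c₁ := ENNReal.toReal_pos (hypArea_pos_of_isOpen isOpen_ball
    ⟨0, by simp [hρ0]⟩ (ball_subset_ball (by linarith))).ne' (hfin _ (by linarith)).ne
  obtain ⟨m, hm0, hm⟩ := exists_le_discWeight (ξ := ξ) hξ hb hp0 (Real.sqrt_nonneg (1 - a))
    ((Real.sqrt_lt' one_pos).2 (by linarith) : √(1 - a) < 1)
  -- Outside the ball of radius `r₀` one has `1 - |v|² ≤ a`, so the weight is sub-mean there; on the
  -- ball the weight is at least `m`.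
  set r₀ := √(1 - a) with hr₀
  have hr₀1 : r₀ < 1 := (Real.sqrt_lt' one_pos).2 (by linarith)
  set C₂ := C₁ * Λ + (C₁ + 1) * Λ * B * (2 / m) with hC₂
  have hC₂0 : 0 < C₂ + 1 := by positivity
  refine ⟨C₁ / (c₀ * c₁) * (C₂ + 1), by positivity, fun h M S hd h0 hM hS => ?_⟩
  set u : ℂ → ℝ := fun z => Real.log ‖h z‖ with hu
  have hum : AEStronglyMeasurable u hypArea := aestronglyMeasurable_log_norm hd
  have huφ : Integrable (fun z => u z * φ z) hypArea :=
    integrable_mul_discWeight hξ hb hum (integrable_log_norm_mul_rpow hd h0 hM hp)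
  have hφi : Integrable φ hypArea := integrable_discWeight hξ hb hp
  have hφpos : ∀ z, ‖z‖ < 1 → 0 < φ z := fun z hz => discWeight_pos hξ hz
  have hupos : Integrable (fun z => max (u z) 0 * φ z) hypArea := by
    refine huφ.pos_part.congr ?_
    filter_upwards [ae_hypArea_mem] with z hz
    rw [max_mul_of_nonneg _ _ (hφpos z hz).le, zero_mul]
  obtain ⟨hi1, hi2, hcomm⟩ := integral_mul_hypMean_comm hρ (measurable_discWeight ξ b p)
    (fun z hz => (hφpos z hz).le)
    (fun w v hw hv hwv => discWeight_le_of_norm_mob_le hξ hb hp0 hw hv hwv) hum huφ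
  have hlocal : ∀ w, ‖w‖ < 1 → IntegrableOn u {v | ‖mob w v‖ < ρ} hypArea := fun w hw => by
    refine integrableOn_of_le_discWeight (c := φ w / C₁) (measurableSet_hypBall ρ w) hξ
      (div_pos (hφpos w hw) hC₁0) (fun v hv hv1 => ?_) hum huφ
    rw [div_le_iff₀' hC₁0]
    refine discWeight_le_of_norm_mob_le hξ hb hp0 hv1 hw ?_
    rw [norm_mob_comm]
    exact (show ‖mob w v‖ < ρ from hv).le.trans hρ
  -- the gain from the zeros
  have hstep1 : ∀ z, ‖z‖ < 1 →
      φ z / C₁ * c₁ ≤ ∫ w, φ w * {v | ‖mob z v‖ < ρ / 4}.indicator 1 w ∂hypArea := fun z hz => by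
    have e : ∀ w, φ w * {v | ‖mob z v‖ < ρ / 4}.indicator 1 w =
        {v | ‖mob z v‖ < ρ / 4}.indicator φ w := fun w => by
      by_cases hw : w ∈ {v | ‖mob z v‖ < ρ / 4} <;> simp [hw]
    simp only [e]
    rw [integral_indicator (measurableSet_hypBall _ z), hc₁, Measure.real, ← hypArea_hypBall hz,
      ← Measure.real, mul_comm, ← smul_eq_mul, ← setIntegral_const]
    refine setIntegral_mono_ae_restrict (integrableOn_const ?_) hφi.integrableOn ?_
    · rw [hypArea_hypBall hz]
      exact (hfin _ (by linarith)).ne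
    · filter_upwards [ae_restrict_mem (measurableSet_hypBall _ z),
        ae_restrict_of_ae ae_hypArea_mem] with w hw hw1
      rw [div_le_iff₀' hC₁0]
      refine discWeight_le_of_norm_mob_le hξ hb hp0 hw1 hz ?_
      rw [norm_mob_comm]
      linarith [show ‖mob z w‖ < ρ / 4 from hw]
  have hgi : ∀ z, Integrable (fun w => φ w * {v | ‖mob z v‖ < ρ / 4}.indicator 1 w) hypArea :=
    fun z => by
      refine (hφi.indicator (measurableSet_hypBall (ρ / 4) z)).congr
        (Filter.Eventually.of_forall fun w => ?_)
      by_cases hw : w ∈ {v | ‖mob z v‖ < ρ / 4} <;> simp [hw]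
  have hgs : Integrable (fun w => ∑ z ∈ S, (analyticOrderNatAt h z : ℝ) *
      (φ w * {v | ‖mob z v‖ < ρ / 4}.indicator 1 w)) hypArea :=
    integrable_finsetSum _ fun z _ => (hgi z).const_mul _
  -- The Jensen gain is multiplied by `φ` and integrated; it holds off the null set of zeros of `h`.
  have hstep2 : c₀ * ∑ z ∈ S, (analyticOrderNatAt h z : ℝ) * (φ z / C₁ * c₁) ≤
      ∫ w, (φ w * hypMean ρ u w - Λ * (u w * φ w)) ∂hypArea := by
    calc c₀ * ∑ z ∈ S, (analyticOrderNatAt h z : ℝ) * (φ z / C₁ * c₁)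
        ≤ c₀ * ∑ z ∈ S, (analyticOrderNatAt h z : ℝ) *
            ∫ w, φ w * {v | ‖mob z v‖ < ρ / 4}.indicator 1 w ∂hypArea := by
          gcongr with z hz
          exact hstep1 z (hS z hz).1
      _ = ∫ w, c₀ * ∑ z ∈ S, (analyticOrderNatAt h z : ℝ) *
            (φ w * {v | ‖mob z v‖ < ρ / 4}.indicator 1 w) ∂hypArea := by
          rw [integral_const_mul, integral_finsetSum _ fun z _ => (hgi z).const_mul _]
          simp only [integral_const_mul]
      _ ≤ _ := by
          refine integral_mono_ae (hgs.const_mul c₀) (hi1.sub (huφ.const_mul Λ)) ?_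
          filter_upwards [ae_hypArea_mem, ae_hypArea_ne_zero hd h0] with w hw hw0
          have key := add_sum_order_le_hypMean hd hw hw0 (by linarith) (hlocal w hw) S hS
          have e : ∑ z ∈ S, (analyticOrderNatAt h z : ℝ) *
              (φ w * {v | ‖mob z v‖ < ρ / 4}.indicator 1 w) =
              φ w * ∑ z ∈ S, (analyticOrderNatAt h z : ℝ) *
                {v | ‖mob z v‖ < ρ / 4}.indicator 1 w := by
            rw [Finset.mul_sum]
            exact Finset.sum_congr rfl fun z _ => by ring
          rw [e]
          have := mul_le_mul_of_nonneg_left key (hφpos w hw).le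
          linarith
  -- the upper bound
  have hball : IntegrableOn u (ball 0 r₀) hypArea :=
    integrableOn_of_le_discWeight measurableSet_ball hξ hm0
      (fun z hz _ => hm z (show ‖z‖ < r₀ by simpa using hz).le) hum huφ
  have hinner : ∫ z in ball 0 r₀, |u z| ∂hypArea ≤
      2 / m * ∫ z, max (u z) 0 * φ z ∂hypArea := by
    have h1 : ∫ z in ball 0 r₀, max (u z) 0 ∂hypArea ≤
        ∫ z in ball 0 r₀, m⁻¹ * (max (u z) 0 * φ z) ∂hypArea := by
      refine setIntegral_mono_on hball.pos_part (hupos.const_mul _).integrableOn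
        measurableSet_ball fun z hz => ?_
      rw [inv_mul_eq_div, le_div_iff₀ hm0]
      exact mul_le_mul_of_nonneg_left (hm z (show ‖z‖ < r₀ by simpa using hz).le)
        (le_max_right _ _)
    have h2 : ∫ z in ball 0 r₀, m⁻¹ * (max (u z) 0 * φ z) ∂hypArea ≤
        ∫ z, m⁻¹ * (max (u z) 0 * φ z) ∂hypArea := by
      refine setIntegral_le_integral (hupos.const_mul _) ?_
      filter_upwards [ae_hypArea_mem] with z hz
      exact mul_nonneg (inv_nonneg.2 hm0.le) (mul_nonneg (le_max_right _ _) (hφpos z hz).le)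
    have h4 : ∫ z, m⁻¹ * (max (u z) 0 * φ z) ∂hypArea =
      m⁻¹ * ∫ z, max (u z) 0 * φ z ∂hypArea := integral_const_mul _ _
    have h3 := setIntegral_abs_log_norm_le hd h0 hr₀1 hball
    calc _ ≤ _ := h3
      _ ≤ 2 * (m⁻¹ * ∫ z, max (u z) 0 * φ z ∂hypArea) := by linarith [h1.trans h2, h4]
      _ = _ := by ring
  have hstep3 : ∫ v, (u v * hypMean ρ φ v - Λ * (u v * φ v)) ∂hypArea ≤
      C₂ * ∫ z, max (u z) 0 * φ z ∂hypArea := by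
    have hind : Integrable ((ball (0 : ℂ) r₀).indicator fun z => |u z|) hypArea :=
      (integrable_indicator_iff measurableSet_ball).2 hball.abs
    calc ∫ v, (u v * hypMean ρ φ v - Λ * (u v * φ v)) ∂hypArea
        ≤ ∫ v, (C₁ * Λ * (max (u v) 0 * φ v) +
            (C₁ + 1) * Λ * B * (ball (0 : ℂ) r₀).indicator (fun z => |u z|) v) ∂hypArea := by
          refine integral_mono_ae (hi2.sub (huφ.const_mul Λ))
            ((hupos.const_mul _).add (hind.const_mul _)) ?_
          filter_upwards [ae_hypArea_mem] with v hv
          have hup := hypMean_discWeight_le (ρ := ρ) hξ hb hp hv hρ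
          have hφv := hφpos v hv
          have hmean0 : 0 ≤ hypMean ρ φ v := by
            refine integral_nonneg_of_ae ?_
            filter_upwards [ae_restrict_of_ae ae_hypArea_mem] with z hz
            exact (hφpos _ (norm_mob_lt_one hv hz)).le
          by_cases hva : 1 - ‖v‖ ^ 2 ≤ a
          · have hlow := le_hypMean_discWeight hξ hb hp hv (by linarith)
              (fun r hr0 hr => hsub v hv hva r hr0 hr)
            -- Only here does the sign of `Mφ - Λφ` matter: it allows `u` to be replaced by its
            -- positive part.
            have h1 : u v * (hypMean ρ φ v - Λ * φ v) ≤
                max (u v) 0 * (hypMean ρ φ v - Λ * φ v) :=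
              mul_le_mul_of_nonneg_right (le_max_left _ _) (sub_nonneg.2 hlow)
            have h2 : max (u v) 0 * (hypMean ρ φ v - Λ * φ v) ≤
                max (u v) 0 * (C₁ * Λ * φ v) := by
              refine mul_le_mul_of_nonneg_left ?_ (le_max_right _ _)
              nlinarith [mul_nonneg hΛ0 hφv.le]
            have h3 : 0 ≤ (C₁ + 1) * Λ * B * (ball (0 : ℂ) r₀).indicator (fun z => |u z|) v :=
              mul_nonneg (by positivity) (indicator_nonneg (fun _ _ => abs_nonneg _) _)
            linarith
          -- On the inner ball the sign is unknown, and absolute values are taken; `hinner` then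
          -- controls `|u|` by `u₊`.
          · have hvr : v ∈ ball (0 : ℂ) r₀ := by
              rw [mem_ball_zero_iff, hr₀]
              exact Real.lt_sqrt_of_sq_lt (by linarith)
            rw [indicator_of_mem hvr]
            have h1 : u v * (hypMean ρ φ v - Λ * φ v) ≤ |u v| * |hypMean ρ φ v - Λ * φ v| := by
              rw [← abs_mul]
              exact le_abs_self _
            have hφB : φ v ≤ B := by
              refine (discWeight_le hξ hb hv).trans ?_
              have := Real.rpow_le_one (one_sub_norm_sq_pos hv).le
                (by nlinarith [norm_nonneg v]) hp0
              nlinarith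
            have h2 : |hypMean ρ φ v - Λ * φ v| ≤ (C₁ + 1) * Λ * B := by
              have h4 : Λ * φ v ≤ Λ * B := mul_le_mul_of_nonneg_left hφB hΛ0
              have h5 : C₁ * (Λ * φ v) ≤ C₁ * (Λ * B) := mul_le_mul_of_nonneg_left h4 hC₁0.le
              have h6 : 0 ≤ Λ * φ v := mul_nonneg hΛ0 hφv.le
              have h7 : 0 ≤ C₁ * (Λ * B) := by positivity
              refine abs_le.2 ⟨by linarith, by linarith⟩
            have h3 : 0 ≤ C₁ * Λ * (max (u v) 0 * φ v) :=
              mul_nonneg (by positivity) (mul_nonneg (le_max_right _ _) hφv.le)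
            have h4 := mul_le_mul_of_nonneg_left h2 (abs_nonneg (u v))
            linarith
      _ = C₁ * Λ * ∫ z, max (u z) 0 * φ z ∂hypArea +
            (C₁ + 1) * Λ * B * ∫ z in ball 0 r₀, |u z| ∂hypArea := by
          rw [integral_add (hupos.const_mul _) (hind.const_mul _), integral_const_mul,
            integral_const_mul, integral_indicator measurableSet_ball]
      _ ≤ _ := by
          have := mul_le_mul_of_nonneg_left hinner
            (by positivity : 0 ≤ (C₁ + 1) * Λ * B)
          rw [hC₂]
          linarith
  have hJ : 0 ≤ ∫ z, max (u z) 0 * φ z ∂hypArea := by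
    refine integral_nonneg_of_ae ?_
    filter_upwards [ae_hypArea_mem] with z hz
    exact mul_nonneg (le_max_right _ _) (hφpos z hz).le
  -- Self-adjointness transfers the mean from `u` to `φ`.
  rw [integral_sub hi1 (huφ.const_mul Λ), hcomm, ← integral_sub hi2 (huφ.const_mul Λ)] at hstep2
  have hfinal := hstep2.trans hstep3
  have e : c₀ * ∑ z ∈ S, (analyticOrderNatAt h z : ℝ) * (φ z / C₁ * c₁) =
      c₀ * c₁ / C₁ * ∑ z ∈ S, (analyticOrderNatAt h z : ℝ) * φ z := by
    rw [Finset.mul_sum, Finset.mul_sum]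
    exact Finset.sum_congr rfl fun z _ => by ring
  rw [e] at hfinal
  have h1 : c₀ * c₁ / C₁ * ∑ z ∈ S, (analyticOrderNatAt h z : ℝ) * φ z ≤
      (C₂ + 1) * ∫ z, max (u z) 0 * φ z ∂hypArea := by linarith
  calc _ = C₁ / (c₀ * c₁) * (c₀ * c₁ / C₁ * ∑ z ∈ S, (analyticOrderNatAt h z : ℝ) * φ z) := by
        field_simp
    _ ≤ C₁ / (c₀ * c₁) * ((C₂ + 1) * ∫ z, max (u z) 0 * φ z ∂hypArea) := by gcongr
    _ = _ := by ring

end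

/-! ### Integrability of the singularities at the boundary points. -/

lemma norm_exp_ofReal_mul_I_sub_one (t : ℝ) : ‖exp (t * I) - 1‖ = |2 * Real.sin (t / 2)| := by
  rw [mul_comm, Complex.norm_exp_I_mul_ofReal_sub_one, Real.norm_eq_abs]

/-- Jordan's inequality compares the sine with the distance to the nearer of the two endpoints. -/
lemma intervalIntegrable_abs_sin_rpow {s : ℝ} (hs0 : 0 ≤ s) (hs : s < 1) :
    IntervalIntegrable (fun t : ℝ => |2 * Real.sin (t / 2)| ^ (-s)) volume 0 (2 * π) := by
  have h1 : IntervalIntegrable (fun t : ℝ => t ^ (-s)) volume 0 (2 * π) :=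
    intervalIntegral.intervalIntegrable_rpow' (by linarith)
  have h2 : IntervalIntegrable (fun t : ℝ => (2 * π - t) ^ (-s)) volume 0 (2 * π) := by
    simpa using (h1.comp_sub_left (2 * π)).symm
  have h3 := (h1.add h2).const_mul ((2 / π) ^ (-s))
  rw [intervalIntegrable_iff_integrableOn_Ioo_of_le two_pi_pos.le] at h3 ⊢
  refine h3.mono' (Measurable.aestronglyMeasurable (by fun_prop)) ?_
  filter_upwards [ae_restrict_mem measurableSet_Ioo] with t ht
  have hπ := pi_pos
  have hsin : 0 < Real.sin (t / 2) := Real.sin_pos_of_pos_of_lt_pi (by linarith [ht.1])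
    (by linarith [ht.2])
  have key : ∀ x, 0 < x → x ≤ π → 2 / π * x ≤ 2 * Real.sin (x / 2) := fun x hx hx' => by
    have := Real.mul_le_sin (x := x / 2) (by linarith) (by linarith)
    linarith
  have hp1 : 0 ≤ t ^ (-s) := Real.rpow_nonneg ht.1.le _
  have hp2 : 0 ≤ (2 * π - t) ^ (-s) := Real.rpow_nonneg (by linarith [ht.2]) _
  have hp3 : 0 ≤ (2 / π) ^ (-s) := Real.rpow_nonneg (by positivity) _
  rw [Real.norm_eq_abs, abs_of_nonneg (Real.rpow_nonneg (abs_nonneg _) _), abs_of_pos (by positivity),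
    mul_add]
  rcases le_total t π with h | h
  · have h4 := Real.rpow_le_rpow_of_nonpos (z := -s) (by have := ht.1; positivity) (key t ht.1 h)
      (by linarith)
    rw [Real.mul_rpow (by positivity) ht.1.le] at h4
    nlinarith [mul_nonneg hp3 hp2]
  · have h5 : Real.sin (t / 2) = Real.sin ((2 * π - t) / 2) := by
      rw [← Real.sin_pi_sub]
      ring_nf
    have h6 : 0 < 2 * π - t := by linarith [ht.2]
    have h4 := Real.rpow_le_rpow_of_nonpos (z := -s) (by positivity)
      (key (2 * π - t) h6 (by linarith)) (by linarith)
    rw [Real.mul_rpow (by positivity) h6.le, ← h5] at h4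
    nlinarith [mul_nonneg hp3 hp1]

lemma circleIntegrable_norm_sub_rpow {a : ℂ} (ha : ‖a‖ = 1) {s : ℝ} (hs0 : 0 ≤ s) (hs : s < 1) :
    CircleIntegrable (fun z => ‖z - a‖ ^ (-s)) 0 1 := by
  have h1 : Function.Periodic (fun θ => ‖circleMap 0 1 θ - a‖ ^ (-s)) (2 * π) :=
    (periodic_circleMap 0 1).comp fun z => ‖z - a‖ ^ (-s)
  have h2 := (intervalIntegrable_abs_sin_rpow hs0 hs).comp_sub_right a.arg
  rw [zero_add, add_comm] at h2
  refine h1.intervalIntegrable two_pi_pos.ne' (t := a.arg) ?_ 0 (2 * π)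
  refine h2.congr fun θ _ => ?_
  congr 1
  have h3 : circleMap 0 1 θ - a = a * (exp ((θ - a.arg : ℝ) * I) - 1) := by
    have h4 : a = exp (a.arg * I) := by
      conv_lhs => rw [← norm_mul_exp_arg_mul_I a, ha]
      simp
    have h5 : a * exp ((θ - a.arg : ℝ) * I) = exp (θ * I) := by
      nth_rewrite 1 [h4]
      rw [← Complex.exp_add]
      push_cast
      ring_nf
    rw [circleMap_zero, ofReal_one, one_mul, mul_sub, mul_one, h5]
  rw [h3, norm_mul, ha, one_mul, norm_exp_ofReal_mul_I_sub_one]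

/-- The points `z` and `rz` differ by at most `1 - r ≤ 1 - |rz| ≤ |rz - a|`. -/
lemma norm_sub_le_two_mul {z a : ℂ} (ha : ‖a‖ = 1) {r : ℝ} (hr0 : 0 ≤ r) (hr : r ≤ 1)
    (hz : ‖z‖ ≤ 1) : ‖z - a‖ ≤ 2 * ‖r * z - a‖ := by
  have h1 : z - a = (1 - r) * z + (r * z - a) := by ring
  have h2 := one_sub_norm_le (z := r * z) ha
  rw [norm_mul, norm_real, Real.norm_eq_abs, abs_of_nonneg hr0] at h2
  have h3 : ‖(1 - (r : ℂ)) * z‖ = (1 - r) * ‖z‖ := by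
    rw [norm_mul, ← ofReal_one, ← ofReal_sub, norm_real, Real.norm_eq_abs, abs_of_nonneg (by linarith)]
  rw [h1]
  refine (norm_add_le _ _).trans ?_
  rw [h3]
  nlinarith

/-- Dilation at most halves the distance to `a`, so the integrable singularity on the unit circle
serves as a majorant for all `r`. -/
lemma exists_circleAverage_norm_sub_rpow_le {a : ℂ} (ha : ‖a‖ = 1) {s : ℝ} (hs0 : 0 ≤ s)
    (hs : s < 1) : ∃ C : ℝ, ∀ r, 0 ≤ r → r < 1 →
      circleAverage (fun z => ‖z - a‖ ^ (-s)) 0 r ≤ C := by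
  have hi := circleIntegrable_norm_sub_rpow ha hs0 hs
  refine ⟨2 ^ s * circleAverage (fun z => ‖z - a‖ ^ (-s)) 0 1, fun r hr0 hr => ?_⟩
  have hne : ∀ z : ℂ, ‖z‖ = 1 → 0 < ‖r * z - a‖ := fun z hz =>
    norm_sub_pos_of_lt (by simpa [hz, abs_of_nonneg hr0] using hr) ha
  rw [circleAverage_eq_circleAverage_zero_one, ← smul_eq_mul, ← circleAverage_fun_smul]
  have hcont : ContinuousOn (fun z : ℂ => ‖(r : ℂ) * z + 0 - a‖ ^ (-s)) (sphere 0 |1|) := by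
    refine ContinuousOn.rpow_const (by fun_prop) fun z hz => Or.inl ?_
    rw [add_zero]
    exact (hne z (by simpa using hz)).ne'
  rw [circleAverage, circleAverage, smul_eq_mul, smul_eq_mul]
  refine mul_le_mul_of_nonneg_left ?_ (by positivity)
  refine intervalIntegral.integral_mono_ae two_pi_pos.le hcont.circleIntegrable'
    (hi.const_mul _) ?_
  have hnull : volume {θ : ℝ | circleMap 0 1 θ = a} = 0 :=
    ((countable_singleton a).preimage_circleMap 0 one_ne_zero).measure_zero _
  filter_upwards [measure_eq_zero_iff_ae_notMem.mp hnull] with θ hθ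
  have hz : ‖circleMap 0 1 θ‖ = 1 := by simp
  have h1 : 0 < ‖circleMap 0 1 θ - a‖ := norm_pos_iff.2 (sub_ne_zero.2 hθ)
  have h2 := norm_sub_le_two_mul ha hr0 hr.le hz.le
  have h3 : ‖circleMap 0 1 θ - a‖ / 2 ≤ ‖r * circleMap 0 1 θ - a‖ := by linarith
  have h4 := Real.rpow_le_rpow_of_nonpos (z := -s) (by positivity) h3 (by linarith)
  rw [Real.div_rpow h1.le zero_le_two, Real.rpow_neg zero_le_two, div_inv_eq_mul,
    mul_comm (‖circleMap 0 1 θ - a‖ ^ (-s))] at h4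
  simpa using h4

lemma integrable_rpow_mul_norm_sub_rpow {a : ℂ} (ha : ‖a‖ = 1) {s : ℝ} (hs0 : 0 ≤ s) (hs : s < 1) :
    Integrable (fun z => (1 - ‖z‖ ^ 2) ^ 2 * (1 - ‖z‖) ^ (-s) * ‖z - a‖ ^ (-s)) hypArea := by
  obtain ⟨C, hC⟩ := exists_circleAverage_norm_sub_rpow_le ha hs0 hs
  have h1 : Integrable (fun z : ℂ => (1 - ‖z‖ ^ 2) ^ 2 * (1 - ‖z‖) ^ (-s)) hypArea := by
    rw [integrable_hypArea_iff]
    refine (integrableOn_one_sub_norm_rpow (s := -s) (by linarith)).congr_fun (fun z hz => ?_)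
      measurableSet_ball
    have := one_sub_norm_sq_pos (mem_unitDisc.1 hz)
    simp only
    field_simp
  have hcongr : ∀ z : ℂ, EqOn
      (fun w => (1 - ‖w‖ ^ 2) ^ 2 * (1 - ‖w‖) ^ (-s) * ‖w - a‖ ^ (-s))
      (fun w => ((1 - ‖z‖ ^ 2) ^ 2 * (1 - ‖z‖) ^ (-s)) • ‖w - a‖ ^ (-s)) (sphere 0 |‖z‖|) :=
    fun z w hw => by
      have hz' : ‖w‖ = ‖z‖ := by simpa using hw
      simp only [hz', smul_eq_mul]
  have hci : ∀ z : ℂ, ‖z‖ < 1 → CircleIntegrable (fun w => ‖w - a‖ ^ (-s)) 0 ‖z‖ := fun z hz => by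
    refine ContinuousOn.circleIntegrable (norm_nonneg z) ?_
    refine ContinuousOn.rpow_const (by fun_prop) fun w hw => Or.inl ?_
    have : ‖w‖ = ‖z‖ := by simpa using hw
    exact (norm_sub_pos_of_lt (this ▸ hz) ha).ne'
  refine integrable_of_circleAverage_le rotInvariant_hypArea
    (m := fun z => C * ((1 - ‖z‖ ^ 2) ^ 2 * (1 - ‖z‖) ^ (-s))) (by fun_prop) (h1.const_mul C) ?_ ?_
  · filter_upwards [ae_hypArea_mem] with z hz
    have h2 : CircleIntegrable
        (fun w => ((1 - ‖z‖ ^ 2) ^ 2 * (1 - ‖z‖) ^ (-s)) • ‖w - a‖ ^ (-s)) 0 ‖z‖ :=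
      (hci z hz).const_mul _
    exact h2.congr fun θ _ => (hcongr z (circleMap_mem_sphere' 0 _ θ)).symm
  · filter_upwards [ae_hypArea_mem] with z hz
    have h3 : 0 ≤ (1 - ‖z‖ ^ 2) ^ 2 * (1 - ‖z‖) ^ (-s) :=
      mul_nonneg (sq_nonneg _) (Real.rpow_nonneg (by linarith) _)
    have h2 : EqOn (fun w => |(1 - ‖w‖ ^ 2) ^ 2 * (1 - ‖w‖) ^ (-s) * ‖w - a‖ ^ (-s)|)
        (fun w => ((1 - ‖z‖ ^ 2) ^ 2 * (1 - ‖z‖) ^ (-s)) • ‖w - a‖ ^ (-s)) (sphere 0 |‖z‖|) := by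
      intro w hw
      have := hcongr z hw
      simp only at this ⊢
      rw [this, smul_eq_mul, abs_of_nonneg]
      positivity
    rw [circleAverage_congr_sphere h2, circleAverage_fun_smul, smul_eq_mul, mul_comm]
    exact mul_le_mul_of_nonneg_right (hC _ (norm_nonneg z) hz) h3

/-- Near any point, at most one factor of `∏ |z - ξ_j| ^ (-s)` is large. -/
lemma exists_prod_rpow_neg_le {N : ℕ} {ξ : Fin N → ℂ} (hinj : Function.Injective ξ) {s : ℝ}
    (hs0 : 0 ≤ s) : ∃ C : ℝ, 0 ≤ C ∧ ∀ z : ℂ, (∀ j, z ≠ ξ j) →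
      ∏ j, ‖z - ξ j‖ ^ (-s) ≤ C * (1 + ∑ j, ‖z - ξ j‖ ^ (-s)) := by
  classical
  -- With all gaps at least `2δ`, a point within `δ` of one `ξ_j` is at least `δ` away from the
  -- others, whose factors are then bounded by `δ^(-s) ≥ 1`.
  have h1 : ∀ᶠ δ : ℝ in nhdsWithin 0 (Ioi 0), (∀ i j, i ≠ j → 2 * δ ≤ ‖ξ i - ξ j‖) ∧ δ ≤ 1 ∧ 0 < δ := by
    refine Filter.Eventually.and ?_ (Filter.Eventually.and ?_ self_mem_nhdsWithin)
    · rw [Filter.eventually_all]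
      intro i
      rw [Filter.eventually_all]
      intro j
      by_cases hij : i = j
      · simp [hij]
      · have h2 : 0 < ‖ξ i - ξ j‖ / 2 := by
          have := norm_pos_iff.2 (sub_ne_zero.2 (hinj.ne hij))
          positivity
        filter_upwards [nhdsWithin_le_nhds (Iio_mem_nhds h2)] with δ hδ _
        linarith [mem_Iio.1 hδ]
    · filter_upwards [nhdsWithin_le_nhds (Iio_mem_nhds one_pos)] with δ hδ
      exact (mem_Iio.1 hδ).le
  obtain ⟨δ, hδ, hδ1, hδ0⟩ := h1.exists
  have hD : 1 ≤ δ ^ (-s) := Real.one_le_rpow_of_pos_of_le_one_of_nonpos hδ0 hδ1 (by linarith)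
  have hfar : ∀ z j, δ ≤ ‖z - ξ j‖ → ‖z - ξ j‖ ^ (-s) ≤ δ ^ (-s) := fun z j hz =>
    Real.rpow_le_rpow_of_nonpos hδ0 hz (by linarith)
  have hprod : ∀ (z : ℂ) (T : Finset (Fin N)), (∀ j ∈ T, δ ≤ ‖z - ξ j‖) →
      ∏ j ∈ T, ‖z - ξ j‖ ^ (-s) ≤ (δ ^ (-s)) ^ N := fun z T hT => by
    refine (Finset.prod_le_prod (fun j _ => by positivity) fun j hj => hfar z j (hT j hj)).trans ?_
    rw [Finset.prod_const]
    exact pow_le_pow_right₀ hD (by simpa using Finset.card_le_univ T)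
  refine ⟨(δ ^ (-s)) ^ N, by positivity, fun z hz => ?_⟩
  have hsum : 0 ≤ ∑ j, ‖z - ξ j‖ ^ (-s) := Finset.sum_nonneg fun j _ => by positivity
  have hDN : 0 ≤ (δ ^ (-s)) ^ N := by positivity
  by_cases hnear : ∃ j, ‖z - ξ j‖ < δ
  · obtain ⟨j, hj⟩ := hnear
    rw [← Finset.mul_prod_erase _ _ (Finset.mem_univ j), mul_comm]
    refine mul_le_mul (hprod z _ fun i hi => ?_) ?_ (by positivity) hDN
    · have h3 := hδ i j (Finset.ne_of_mem_erase hi)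
      have h4 : ξ i - ξ j = (z - ξ j) - (z - ξ i) := by ring
      rw [h4] at h3
      linarith [norm_sub_le (z - ξ j) (z - ξ i)]
    · have := Finset.single_le_sum (f := fun j => ‖z - ξ j‖ ^ (-s)) (fun j _ => by positivity)
        (Finset.mem_univ j)
      linarith
  · push Not at hnear
    have := hprod z Finset.univ fun j _ => hnear j
    nlinarith

/-! ### From bounded functions to the growth condition. -/

/-- The majorant of `log |h|`. -/
noncomputable def growthBound {N : ℕ} (ξ : Fin N → ℂ) (β : Fin N → ℝ) (α γ : ℝ) (z : ℂ) : ℝ :=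
  ‖z‖ ^ γ / (1 - ‖z‖) ^ α * ∏ j, 1 / ‖z - ξ j‖ ^ β j

section

variable {N : ℕ} {ξ : Fin N → ℂ} {β : Fin N → ℝ} {α γ τ : ℝ}

lemma growthBound_nonneg {z : ℂ} (hz : ‖z‖ < 1) : 0 ≤ growthBound ξ β α γ z :=
  mul_nonneg (div_nonneg (Real.rpow_nonneg (norm_nonneg _) _) (Real.rpow_nonneg (by linarith) _))
    (Finset.prod_nonneg fun j _ => by positivity)

lemma growthBound_mul_le (hξ : ∀ j, ‖ξ j‖ = 1) (hα : 0 ≤ α) (hγ : 0 ≤ γ) (hβ : ∀ j, 0 ≤ β j)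
    {r : ℝ} (hr0 : 0 ≤ r) (hr : r ≤ 1) {z : ℂ} (hz : ‖z‖ < 1) :
    growthBound ξ β α γ (r * z) ≤ (∏ j, (2 : ℝ) ^ β j) * growthBound ξ β α γ z := by
  have h1 : ‖(r : ℂ) * z‖ = r * ‖z‖ := by
    rw [norm_mul, norm_real, Real.norm_eq_abs, abs_of_nonneg hr0]
  have h2 : r * ‖z‖ ≤ ‖z‖ := mul_le_of_le_one_left (norm_nonneg z) hr
  have h3 : ∏ j, 1 / ‖(r : ℂ) * z - ξ j‖ ^ β j ≤
      (∏ j, (2 : ℝ) ^ β j) * ∏ j, 1 / ‖z - ξ j‖ ^ β j := by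
    rw [← Finset.prod_mul_distrib]
    refine Finset.prod_le_prod (fun j _ => by positivity) fun j _ => ?_
    have h4 := norm_sub_pos_of_lt hz (hξ j)
    have h5 := norm_sub_le_two_mul (hξ j) hr0 hr hz.le
    have h6 : 0 < ‖(r : ℂ) * z - ξ j‖ := by linarith
    rw [mul_one_div, div_le_div_iff₀ (by positivity) (by positivity), one_mul,
      ← Real.mul_rpow zero_le_two h6.le]
    exact Real.rpow_le_rpow h4.le h5 (hβ j)
  have h7 : ‖(r : ℂ) * z‖ ^ γ / (1 - ‖(r : ℂ) * z‖) ^ α ≤ ‖z‖ ^ γ / (1 - ‖z‖) ^ α := by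
    rw [h1]
    have h8 : 0 < 1 - ‖z‖ := by linarith
    have h9 : 0 ≤ r * ‖z‖ := by positivity
    gcongr
  rw [growthBound, growthBound, mul_left_comm]
  refine mul_le_mul h7 h3 (Finset.prod_nonneg fun j _ => by positivity) ?_
  exact div_nonneg (by positivity) (Real.rpow_nonneg (by linarith) _)

lemma rpow_neg_le_two_mul {x c s : ℝ} (hx : 0 < x) (hx2 : x ≤ 2) (hcs : c ≤ s) (hsc : s ≤ c + 1) :
    x ^ (-c) ≤ 2 * x ^ (-s) := by
  have h1 : x ^ (-c) = x ^ (s - c) * x ^ (-s) := by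
    rw [← Real.rpow_add hx]
    ring_nf
  rw [h1]
  refine mul_le_mul_of_nonneg_right ?_ (by positivity)
  calc x ^ (s - c) ≤ 2 ^ (s - c) := Real.rpow_le_rpow hx.le hx2 (by linarith)
    _ ≤ 2 ^ (1 : ℝ) := Real.rpow_le_rpow_of_exponent_le one_le_two (by linarith)
    _ = 2 := Real.rpow_one 2

lemma measurable_growthBound : Measurable (growthBound ξ β α γ) := by
  unfold growthBound
  fun_prop

/-- After the density `(1 - |z|²)^(-2)`, the radial exponent is `p - α - 2 = τ - 1`. Each boundary
point has exponent `-min(β_j, 1 - τ)`, no worse than `τ - 1`. Both singularities are integrable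
separately, and uniformly bounded circle means allow them to be combined. -/
lemma integrable_growthBound_mul_discWeight (hξ : ∀ j, ‖ξ j‖ = 1) (hinj : Function.Injective ξ)
    (hγ : 0 ≤ γ) (hβ : ∀ j, 0 ≤ β j) (hτ0 : 0 < τ) (hτ1 : τ < 1) :
    Integrable (fun z => growthBound ξ β α γ z *
      discWeight ξ (fun j => max (β j - 1 + τ) 0) (α + 1 + τ) z) hypArea := by
  set s := 1 - τ with hs
  have hs0 : 0 ≤ s := by linarith
  have hs1 : s < 1 := by linarith
  obtain ⟨C, hC0, hC⟩ := exists_prod_rpow_neg_le hinj hs0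
  have hint0 : Integrable (fun z : ℂ => (1 - ‖z‖ ^ 2) ^ 2 * (1 - ‖z‖) ^ (-s)) hypArea := by
    rw [integrable_hypArea_iff]
    refine (integrableOn_one_sub_norm_rpow (s := -s) (by linarith)).congr_fun (fun z hz => ?_)
      measurableSet_ball
    have := one_sub_norm_sq_pos (mem_unitDisc.1 hz)
    simp only
    field_simp
  have hint : Integrable (fun z : ℂ => (1 - ‖z‖ ^ 2) ^ 2 * (1 - ‖z‖) ^ (-s) +
      ∑ j, (1 - ‖z‖ ^ 2) ^ 2 * (1 - ‖z‖) ^ (-s) * ‖z - ξ j‖ ^ (-s)) hypArea :=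
    hint0.add (integrable_finsetSum _ fun j _ => integrable_rpow_mul_norm_sub_rpow (hξ j) hs0 hs1)
  set A : ℝ := 2 ^ max (α + 1 + τ - 2) 0 with hA
  refine (hint.const_mul (A * 2 ^ N * C)).mono'
    (measurable_growthBound.mul (measurable_discWeight _ _ _)).aestronglyMeasurable ?_
  filter_upwards [ae_hypArea_mem] with z hz
  have hz1 := one_sub_norm_sq_pos hz
  have hz2 : 0 < 1 - ‖z‖ := by linarith
  have hzξ : ∀ j, 0 < ‖z - ξ j‖ := fun j => norm_sub_pos_of_lt hz (hξ j)
  rw [Real.norm_eq_abs, abs_of_nonneg (mul_nonneg (growthBound_nonneg hz) (discWeight_pos hξ hz).le)]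
  have h1 : ‖z‖ ^ γ / (1 - ‖z‖) ^ α * (1 - ‖z‖ ^ 2) ^ (α + 1 + τ) ≤
      A * ((1 - ‖z‖ ^ 2) ^ 2 * (1 - ‖z‖) ^ (-s)) := by
    have h2 : (1 - ‖z‖ ^ 2) ^ (α + 1 + τ) =
        (1 - ‖z‖ ^ 2) ^ 2 * (1 - ‖z‖ ^ 2) ^ (α + 1 + τ - 2) := by
      rw [Real.rpow_sub hz1, Real.rpow_two]
      field_simp
    have h3 := one_sub_norm_sq_rpow_le hz (α + 1 + τ - 2)
    have h4 : ‖z‖ ^ γ ≤ 1 := Real.rpow_le_one (norm_nonneg z) hz.le hγ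
    have h5 : (1 - ‖z‖) ^ (α + 1 + τ - 2) / (1 - ‖z‖) ^ α = (1 - ‖z‖) ^ (-s) := by
      rw [← Real.rpow_sub hz2, hs]
      ring_nf
    calc ‖z‖ ^ γ / (1 - ‖z‖) ^ α * (1 - ‖z‖ ^ 2) ^ (α + 1 + τ)
        ≤ 1 / (1 - ‖z‖) ^ α * ((1 - ‖z‖ ^ 2) ^ 2 * (A * (1 - ‖z‖) ^ (α + 1 + τ - 2))) := by
          rw [h2]
          gcongr
      _ = A * ((1 - ‖z‖ ^ 2) ^ 2 * ((1 - ‖z‖) ^ (α + 1 + τ - 2) / (1 - ‖z‖) ^ α)) := by ring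
      _ = _ := by rw [h5]
  have h6 : (∏ j, 1 / ‖z - ξ j‖ ^ β j) * ∏ j, ‖z - ξ j‖ ^ max (β j - 1 + τ) 0 ≤
      2 ^ N * (C * (1 + ∑ j, ‖z - ξ j‖ ^ (-s))) := by
    have h7 : ∀ j ∈ Finset.univ, 1 / ‖z - ξ j‖ ^ β j * ‖z - ξ j‖ ^ max (β j - 1 + τ) 0 ≤
        2 * ‖z - ξ j‖ ^ (-s) := fun j _ => by
      have h8 : 1 / ‖z - ξ j‖ ^ β j * ‖z - ξ j‖ ^ max (β j - 1 + τ) 0 =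
          ‖z - ξ j‖ ^ (-(β j - max (β j - 1 + τ) 0)) := by
        rw [one_div, ← Real.rpow_neg (hzξ j).le, ← Real.rpow_add (hzξ j)]
        ring_nf
      rw [h8]
      have h9 : ‖z - ξ j‖ ≤ 2 := by
        have := norm_sub_le z (ξ j)
        rw [hξ j] at this
        linarith
      refine rpow_neg_le_two_mul (hzξ j) h9 ?_ ?_
      · linarith [le_max_left (β j - 1 + τ) 0]
      · rcases max_cases (β j - 1 + τ) 0 with h | h <;> linarith [hβ j, h.1, h.2]
    rw [← Finset.prod_mul_distrib]
    refine (Finset.prod_le_prod (fun j _ => by positivity) h7).trans ?_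
    rw [Finset.prod_mul_distrib, Finset.prod_const, Finset.card_univ, Fintype.card_fin]
    refine mul_le_mul_of_nonneg_left (hC z fun j hj => ?_) (by positivity)
    have := hzξ j
    rw [hj, sub_self, norm_zero] at this
    exact lt_irrefl _ this
  have h10 : 0 ≤ (∏ j, 1 / ‖z - ξ j‖ ^ β j) * ∏ j, ‖z - ξ j‖ ^ max (β j - 1 + τ) 0 :=
    mul_nonneg (Finset.prod_nonneg fun j _ => by positivity)
      (Finset.prod_nonneg fun j _ => by positivity)
  calc growthBound ξ β α γ z * discWeight ξ (fun j => max (β j - 1 + τ) 0) (α + 1 + τ) z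
      = (‖z‖ ^ γ / (1 - ‖z‖) ^ α * (1 - ‖z‖ ^ 2) ^ (α + 1 + τ)) *
        ((∏ j, 1 / ‖z - ξ j‖ ^ β j) * ∏ j, ‖z - ξ j‖ ^ max (β j - 1 + τ) 0) := by
        rw [growthBound, discWeight]
        ring
    _ ≤ (A * ((1 - ‖z‖ ^ 2) ^ 2 * (1 - ‖z‖) ^ (-s))) *
        (2 ^ N * (C * (1 + ∑ j, ‖z - ξ j‖ ^ (-s)))) :=
        mul_le_mul h1 h6 h10 (by positivity)
    _ = _ := by
        rw [← Finset.mul_sum]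
        ring

lemma continuousAt_discWeight {b : Fin N → ℝ} {p : ℝ} (hξ : ∀ j, ‖ξ j‖ = 1) {z : ℂ}
    (hz : ‖z‖ < 1) : ContinuousAt (discWeight ξ b p) z := by
  unfold discWeight
  refine ContinuousAt.mul (ContinuousAt.rpow_const (by fun_prop)
    (Or.inl (one_sub_norm_sq_pos hz).ne')) ?_
  exact tendsto_finsetProd _ fun j _ =>
    ContinuousAt.rpow_const (by fun_prop) (Or.inl (norm_sub_pos_of_lt hz (hξ j)).ne')

lemma analyticOrderNatAt_comp_const_mul (h : ℂ → ℂ) {c : ℂ} (hc : c ≠ 0) (z : ℂ) :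
    analyticOrderNatAt (fun z => h (c * z)) (z / c) = analyticOrderNatAt h z := by
  have h1 : HasDerivAt (fun z => c * z) c (z / c) := by
    simpa using (hasDerivAt_id (z / c)).const_mul c
  have h2 := analyticOrderAt_comp_of_deriv_ne_zero (f := h) (g := fun z => c * z) (z₀ := z / c)
    (by fun_prop) (by rwa [h1.deriv])
  rw [mul_div_cancel₀ _ hc] at h2
  rw [analyticOrderNatAt, analyticOrderNatAt, ← h2]
  rfl

/-- The zero-counting estimate with a weight that does not degenerate at the origin. -/
theorem exists_sum_order_mul_discWeight_le_mul (hξ : ∀ j, ‖ξ j‖ = 1) (hinj : Function.Injective ξ)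
    (hα : 0 ≤ α) (hγ : 0 ≤ γ) (hβ : ∀ j, 0 ≤ β j) (hτ0 : 0 < τ) (hτ1 : τ < 1) :
    ∃ C : ℝ, 0 < C ∧ ∀ (h : ℂ → ℂ) (K : ℝ) (S : Finset ℂ), DifferentiableOn ℂ h unitDisc →
      h 0 = 1 → 0 ≤ K →
      (∀ z ∈ unitDisc, h z ≠ 0 → Real.log ‖h z‖ ≤ K * growthBound ξ β α γ z) →
      (∀ z ∈ S, ‖z‖ < 1 ∧ h z = 0) →
      ∑ z ∈ S, (analyticOrderNatAt h z : ℝ) *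
        discWeight ξ (fun j => max (β j - 1 + τ) 0) (α + 1 + τ) z ≤ C * K := by
  classical
  obtain ⟨C, hC0, hC⟩ := exists_sum_order_mul_discWeight_le (ξ := ξ)
    (b := fun j => max (β j - 1 + τ) 0) (p := α + 1 + τ) hξ (fun j => le_max_right _ _) (by linarith)
  have hint := integrable_growthBound_mul_discWeight (α := α) hξ hinj hγ hβ hτ0 hτ1
  set φ := discWeight ξ (fun j => max (β j - 1 + τ) 0) (α + 1 + τ) with hφ
  set J := ∫ z, growthBound ξ β α γ z * φ z ∂hypArea with hJ
  set B : ℝ := ∏ j, (2 : ℝ) ^ β j with hB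
  have hB0 : 0 < B := Finset.prod_pos fun j _ => by positivity
  have hJ0 : 0 ≤ J := by
    refine integral_nonneg_of_ae ?_
    filter_upwards [ae_hypArea_mem] with z hz
    exact mul_nonneg (growthBound_nonneg hz) (discWeight_pos hξ hz).le
  -- The summand 1 only secures positivity, `J` being known merely to be nonnegative.
  refine ⟨C * (B * J) + 1, by positivity, fun h K S hd h0 hK hlog hS => ?_⟩
  have hRall : ∀ᶠ R : ℝ in nhdsWithin 1 (Iio 1), (0 < R ∧ ∀ z ∈ S, ‖z‖ < R) ∧ R < 1 := by
    refine Filter.Eventually.and (nhdsWithin_le_nhds (Filter.Eventually.and ?_ ?_))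
      self_mem_nhdsWithin
    · exact Ioi_mem_nhds one_pos
    · rw [Filter.eventually_all_finset]
      exact fun z hz => Ioi_mem_nhds (hS z hz).1
  have htend : Filter.Tendsto (fun R : ℝ => ∑ z ∈ S, (analyticOrderNatAt h z : ℝ) * φ (z / R))
      (nhdsWithin 1 (Iio 1)) (nhds (∑ z ∈ S, (analyticOrderNatAt h z : ℝ) * φ z)) := by
    refine tendsto_finsetSum _ fun z hz => Filter.Tendsto.const_mul _ ?_
    have h1 : Filter.Tendsto (fun R : ℝ => z / (R : ℂ)) (nhdsWithin 1 (Iio 1)) (nhds z) := by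
      have h2 : ContinuousAt (fun R : ℝ => z / (R : ℂ)) 1 :=
        ContinuousAt.div (by fun_prop) (by fun_prop) (by simp)
      have h3 := h2.tendsto
      simp only [ofReal_one, div_one] at h3
      exact h3.mono_left nhdsWithin_le_nhds
    exact (continuousAt_discWeight hξ (hS z hz).1).tendsto.comp h1
  -- The zeros of `h(Rz)` are the points `z/R`. The bound is proved for `R < 1` near 1 and passes to
  -- the limit by continuity of the weight.
  refine le_of_tendsto htend ?_
  filter_upwards [hRall] with R hR
  obtain ⟨⟨hR0, hRS⟩, hR1⟩ := hR
  have hR0' : (R : ℂ) ≠ 0 := by exact_mod_cast hR0.ne'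
  have hnorm : ∀ z : ℂ, ‖(R : ℂ) * z‖ = R * ‖z‖ := fun z => by
    rw [norm_mul, norm_real, Real.norm_eq_abs, abs_of_pos hR0]
  set g : ℂ → ℂ := fun z => h (R * z) with hg
  have hmaps : MapsTo (fun z : ℂ => (R : ℂ) * z) unitDisc unitDisc := fun z hz => by
    rw [mem_unitDisc] at hz ⊢
    rw [hnorm]
    nlinarith [norm_nonneg z]
  have hgd : DifferentiableOn ℂ g unitDisc := hd.comp (by fun_prop) hmaps
  have hg0 : g 0 = 1 := by simp [hg, h0]
  -- The dilated function is bounded; its bound `M` depends on `R` but does not enter the constant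
  -- `C`.
  obtain ⟨M, hM⟩ := (isCompact_closedBall (0 : ℂ) R).exists_bound_of_continuousOn
    (hd.continuousOn.mono (closedBall_subset_ball hR1))
  have hgM : ∀ z, ‖z‖ < 1 → Real.log ‖g z‖ ≤ M := fun z hz => by
    refine (Real.log_le_self (norm_nonneg _)).trans (hM _ ?_)
    rw [mem_closedBall_zero_iff, hnorm]
    nlinarith [norm_nonneg z]
  have hgS : ∀ z ∈ S.image (fun z => z / (R : ℂ)), ‖z‖ < 1 ∧ g z = 0 := fun z hz => by
    obtain ⟨w, hw, rfl⟩ := Finset.mem_image.1 hz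
    refine ⟨?_, ?_⟩
    · rw [norm_div, norm_real, Real.norm_eq_abs, abs_of_pos hR0, div_lt_one hR0]
      exact hRS w hw
    · simp only [hg]
      rw [mul_div_cancel₀ _ hR0', (hS w hw).2]
  have key := hC g M _ hgd hg0 hgM hgS
  rw [Finset.sum_image fun x _ y _ hxy => by simpa [hR0'] using hxy] at key
  have e : ∀ z, analyticOrderNatAt g (z / R) = analyticOrderNatAt h z :=
    analyticOrderNatAt_comp_const_mul h hR0'
  simp only [e] at key
  refine key.trans ?_
  have hle : ∫ z, max (Real.log ‖g z‖) 0 * φ z ∂hypArea ≤ K * B * J := by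
    rw [hJ, ← integral_const_mul]
    refine integral_mono_of_nonneg ?_ (hint.const_mul _) ?_
    · filter_upwards [ae_hypArea_mem] with z hz
      exact mul_nonneg (le_max_right _ _) (discWeight_pos hξ hz).le
    · filter_upwards [ae_hypArea_mem] with z hz
      rw [← mul_assoc]
      refine mul_le_mul_of_nonneg_right ?_ (discWeight_pos hξ hz).le
      have h1 : 0 ≤ K * B * growthBound ξ β α γ z :=
        mul_nonneg (by positivity) (growthBound_nonneg hz)
      refine max_le ?_ h1
      by_cases hgz : g z = 0
      · rw [hgz, norm_zero, Real.log_zero]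
        exact h1
      · refine (hlog _ (hmaps (mem_unitDisc.2 hz)) hgz).trans ?_
        rw [mul_assoc]
        exact mul_le_mul_of_nonneg_left (growthBound_mul_le hξ hα hγ hβ hR0.le hR1.le hz) hK
  have := mul_le_mul_of_nonneg_left hle hC0.le
  nlinarith

end

/-! ### Zeros near the origin. -/

section

variable {N : ℕ} {ξ : Fin N → ℂ} {β : Fin N → ℝ} {α γ τ : ℝ}

lemma growthBound_le_of_norm_le (hξ : ∀ j, ‖ξ j‖ = 1) (hα : 0 ≤ α) (hβ : ∀ j, 0 ≤ β j) {z : ℂ}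
    (hz : ‖z‖ ≤ 3 / 4) :
    growthBound ξ β α γ z ≤ (4 ^ α * ∏ j, (4 : ℝ) ^ β j) * ‖z‖ ^ γ := by
  have h1 : ‖z‖ ^ γ / (1 - ‖z‖) ^ α ≤ ‖z‖ ^ γ * 4 ^ α := by
    rw [div_le_iff₀ (Real.rpow_pos_of_pos (by linarith) _), mul_assoc,
      ← Real.mul_rpow (by norm_num) (by linarith)]
    exact le_mul_of_one_le_right (by positivity) (Real.one_le_rpow (by linarith) hα)
  have h2 : ∏ j, 1 / ‖z - ξ j‖ ^ β j ≤ ∏ j, (4 : ℝ) ^ β j := by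
    refine Finset.prod_le_prod (fun j _ => by positivity) fun j _ => ?_
    have h3 := one_sub_norm_le (z := z) (hξ j)
    rw [div_le_iff₀ (Real.rpow_pos_of_pos (by linarith) _),
      ← Real.mul_rpow (by norm_num) (norm_nonneg _)]
    exact Real.one_le_rpow (by linarith) (hβ j)
  calc growthBound ξ β α γ z ≤ (‖z‖ ^ γ * 4 ^ α) * ∏ j, (4 : ℝ) ^ β j :=
        mul_le_mul h1 h2 (Finset.prod_nonneg fun j _ => by positivity) (by positivity)
    _ = _ := by ring

lemma growthBound_pos (hξ : ∀ j, ‖ξ j‖ = 1) {z : ℂ} (hz : ‖z‖ < 1) (hz0 : z ≠ 0) :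
    0 < growthBound ξ β α γ z :=
  mul_pos (div_pos (Real.rpow_pos_of_pos (norm_pos_iff.2 hz0) _)
    (Real.rpow_pos_of_pos (by linarith) _)) (Finset.prod_pos fun j _ =>
      one_div_pos.2 (Real.rpow_pos_of_pos (norm_sub_pos_of_lt hz (hξ j)) _))

/-- If `K < 0`, then `|h| ≤ 1 = |h(0)|`, so `|h| = 1` throughout by the maximum principle. This
contradicts the strict negativity of the bound at `1/2`. -/
lemma nonneg_of_log_norm_le (hξ : ∀ j, ‖ξ j‖ = 1) {h : ℂ → ℂ} {K : ℝ}
    (hd : DifferentiableOn ℂ h unitDisc) (h0 : h 0 = 1)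
    (hlog : ∀ z ∈ unitDisc, h z ≠ 0 → Real.log ‖h z‖ ≤ K * growthBound ξ β α γ z) : 0 ≤ K := by
  by_contra! hK
  have hle : ∀ z ∈ unitDisc, ‖h z‖ ≤ 1 := fun z hz => by
    by_cases hz0 : h z = 0
    · simp [hz0]
    · refine (Real.log_nonpos_iff (norm_nonneg _)).1 ((hlog z hz hz0).trans ?_)
      exact mul_nonpos_of_nonpos_of_nonneg hK.le (growthBound_nonneg (mem_unitDisc.1 hz))
  have hmem : (0 : ℂ) ∈ unitDisc := by simp
  have hmax : IsMaxOn (norm ∘ h) unitDisc 0 := fun z hz => by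
    simpa [h0] using hle z hz
  have heq := norm_eqOn_of_isPreconnected_of_isMaxOn (convex_ball (0 : ℂ) 1).isPreconnected
    isOpen_ball hd hmem hmax
  have hhalf : (1 / 2 : ℂ) ∈ unitDisc := by rw [mem_unitDisc]; norm_num
  have h1 : ‖h (1 / 2)‖ = 1 := by
    have := heq hhalf
    simpa [h0] using this
  have h2 := hlog _ hhalf (norm_ne_zero_iff.1 (by rw [h1]; norm_num))
  rw [h1, Real.log_one] at h2
  have h3 := growthBound_pos (β := β) (α := α) (γ := γ) hξ (mem_unitDisc.1 hhalf) (by norm_num)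
  nlinarith

lemma sum_order_mul_log_le (hξ : ∀ j, ‖ξ j‖ = 1) (hα : 0 ≤ α) (hβ : ∀ j, 0 ≤ β j) {h : ℂ → ℂ}
    {K : ℝ} (hd : DifferentiableOn ℂ h unitDisc) (h0 : h 0 = 1) (hK : 0 ≤ K)
    (hlog : ∀ z ∈ unitDisc, h z ≠ 0 → Real.log ‖h z‖ ≤ K * growthBound ξ β α γ z) {r : ℝ}
    (hr0 : 0 < r) (hr : r ≤ 3 / 4) (S : Finset ℂ) (hS : ∀ z ∈ S, ‖z‖ ≤ r) :
    ∑ z ∈ S, (analyticOrderNatAt h z : ℝ) * Real.log (r / ‖z‖) ≤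
      (4 ^ α * ∏ j, (4 : ℝ) ^ β j) * K * r ^ γ := by
  have hr1 : r < 1 := by linarith
  have h1 := sum_order_mul_log_le_circleAverage hr0
    ((hd.analyticOnNhd isOpen_ball).mono (closedBall_subset_ball hr1)) (by simp [h0]) S hS
  rw [h0, norm_one, Real.log_one, add_zero] at h1
  refine h1.trans (circleAverage_mono_on_of_le_circle (circleIntegrable_log_norm hd hr0.le hr1) ?_)
  intro z hz
  have hz' : ‖z‖ = r := by simpa [abs_of_pos hr0] using hz
  have hD : 0 ≤ (4 : ℝ) ^ α * ∏ j, (4 : ℝ) ^ β j :=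
    mul_nonneg (by positivity) (Finset.prod_nonneg fun j _ => by positivity)
  by_cases hz0 : h z = 0
  · rw [hz0, norm_zero, Real.log_zero]
    positivity
  · refine (hlog z (mem_unitDisc.2 (hz' ▸ hr1)) hz0).trans ?_
    have h2 := growthBound_le_of_norm_le (γ := γ) hξ hα hβ (hz'.le.trans hr)
    rw [hz'] at h2
    nlinarith [mul_le_mul_of_nonneg_left h2 hK]

/-- The zero-counting estimate near the origin. -/
theorem exists_sum_order_mul_rpow_le (hξ : ∀ j, ‖ξ j‖ = 1) (hα : 0 ≤ α) (hγ : 0 ≤ γ)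
    (hβ : ∀ j, 0 ≤ β j) (hτ1 : τ < 1) :
    ∃ C : ℝ, 0 < C ∧ ∀ (h : ℂ → ℂ) (K : ℝ) (S : Finset ℂ), DifferentiableOn ℂ h unitDisc →
      h 0 = 1 → 0 ≤ K →
      (∀ z ∈ unitDisc, h z ≠ 0 → Real.log ‖h z‖ ≤ K * growthBound ξ β α γ z) →
      (∀ z ∈ S, ‖z‖ < 1 / 2 ∧ h z = 0) →
      ∑ z ∈ S, (analyticOrderNatAt h z : ℝ) * ‖z‖ ^ (-max (γ - 1 + τ) 0) ≤ C * K := by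
  classical
  set D : ℝ := 4 ^ α * ∏ j, (4 : ℝ) ^ β j with hD
  have hD0 : 0 < D := mul_pos (by positivity) (Finset.prod_pos fun j _ => by positivity)
  have hl : 0 < Real.log (3 / 2) := Real.log_pos (by norm_num)
  have hlogle : ∀ {r x : ℝ}, 0 < x → 3 / 2 * x ≤ r → Real.log (3 / 2) ≤ Real.log (r / x) :=
    fun hx hr => Real.log_le_log (by norm_num) ((le_div_iff₀ hx).2 hr)
  rcases le_or_gt (γ - 1 + τ) 0 with hg | hg
  -- Without a singular weight, one Jensen circle of radius `3/4` suffices: zeros of modulus below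
  -- `1/2` each contribute at least `log (3/2)`.
  · refine ⟨D / Real.log (3 / 2), by positivity, fun h K S hd h0 hK hlog hS => ?_⟩
    rw [max_eq_right hg]
    simp only [neg_zero, Real.rpow_zero, mul_one]
    have h1 := sum_order_mul_log_le hξ hα hβ hd h0 hK hlog (r := 3 / 4) (by norm_num) le_rfl S
      fun z hz => by linarith [(hS z hz).1]
    rw [← hD] at h1
    have h2 : ((3 : ℝ) / 4) ^ γ ≤ 1 := Real.rpow_le_one (by norm_num) (by norm_num) hγ
    have h3 : (∑ z ∈ S, (analyticOrderNatAt h z : ℝ)) * Real.log (3 / 2) ≤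
        ∑ z ∈ S, (analyticOrderNatAt h z : ℝ) * Real.log (3 / 4 / ‖z‖) := by
      rw [Finset.sum_mul]
      refine Finset.sum_le_sum fun z hz => mul_le_mul_of_nonneg_left ?_ (Nat.cast_nonneg _)
      have hz0 : 0 < ‖z‖ := by
        rw [norm_pos_iff]
        rintro rfl
        simpa [h0] using (hS _ hz).2
      exact hlogle (r := 3 / 4) hz0 (by linarith [(hS z hz).1])
    rw [div_mul_eq_mul_div, le_div_iff₀ hl]
    have : D * K * (3 / 4) ^ γ ≤ D * K := mul_le_of_le_one_right (by positivity) h2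
    linarith
  · rw [max_eq_left hg.le]
    set g := γ - 1 + τ with hgdef
    set r : ℕ → ℝ := fun n => 3 / 4 * (1 / 2) ^ n with hr
    have hr0 : ∀ n, 0 < r n := fun n => by positivity
    have hr34 : ∀ n, r n ≤ 3 / 4 := fun n => by
      have : ((1 : ℝ) / 2) ^ n ≤ 1 := pow_le_one₀ (by norm_num) (by norm_num)
      simp only [hr]
      linarith
    set q : ℝ := (1 / 2) ^ (1 - τ) with hq
    have hq0 : 0 < q := by positivity
    have hq1 : q < 1 := Real.rpow_lt_one (by norm_num) (by norm_num) (by linarith)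
    -- Since `γ - g = 1 - τ > 0`, the weighted Jensen bounds decay geometrically.
    have hrq : ∀ n, r n ^ (-g) * r n ^ γ ≤ q ^ n := fun n => by
      rw [← Real.rpow_add (hr0 n), show -g + γ = 1 - τ by rw [hgdef]; ring, hr,
        Real.mul_rpow (by norm_num) (by positivity), hq, ← Real.rpow_natCast,
        ← Real.rpow_natCast, ← Real.rpow_mul (by norm_num), ← Real.rpow_mul (by norm_num),
        mul_comm (n : ℝ)]
      exact mul_le_of_le_one_left (by positivity)
        (Real.rpow_le_one (by norm_num) (by norm_num) (by linarith))
    refine ⟨3 ^ g / Real.log (3 / 2) * (D * (1 - q)⁻¹), ?_, fun h K S hd h0 hK hlog hS => ?_⟩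
    · have : 0 < 1 - q := by linarith
      positivity
    have hpos : ∀ z ∈ S, 0 < ‖z‖ := fun z hz => by
      rw [norm_pos_iff]
      rintro rfl
      simpa [h0] using (hS _ hz).2
    set F : ℂ → ℕ → ℝ := fun z n => if ‖z‖ ≤ r n then
      (analyticOrderNatAt h z : ℝ) * Real.log (r n / ‖z‖) else 0 with hF
    have hF0 : ∀ z ∈ S, ∀ n, 0 ≤ F z n := fun z hz n => by
      simp only [hF]
      split_ifs with hzr
      · exact mul_nonneg (Nat.cast_nonneg _)
          (Real.log_nonneg ((one_le_div (hpos z hz)).2 hzr))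
      · exact le_rfl
    -- Each zero is charged to a dyadic radius with `(3/2)|z| ≤ r_n ≤ 3|z|`: the left inequality
    -- gives a Jensen term of at least `log (3/2)`, the right one compares the weights.
    have hscale : ∀ z ∈ S, ∃ n, (analyticOrderNatAt h z : ℝ) * ‖z‖ ^ (-g) ≤
        3 ^ g / Real.log (3 / 2) * (r n ^ (-g) * F z n) := fun z hz => by
      have hz0 := hpos z hz
      obtain ⟨n, hn1, hn2⟩ := exists_nat_pow_near_of_lt_one (x := 2 * ‖z‖) (y := 1 / 2)
        (by positivity) (by linarith [(hS z hz).1]) (by norm_num) (by norm_num)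
      have h1 : 3 / 2 * ‖z‖ ≤ r n := by simp only [hr]; linarith
      have h2 : r n ≤ 3 * ‖z‖ := by
        simp only [hr]
        rw [pow_succ] at hn1
        linarith
      refine ⟨n, ?_⟩
      have h3 : F z n = (analyticOrderNatAt h z : ℝ) * Real.log (r n / ‖z‖) :=
        if_pos (by linarith)
      have h4 : ‖z‖ ^ (-g) ≤ 3 ^ g * r n ^ (-g) := by
        have := Real.rpow_le_rpow_of_nonpos (hr0 n) h2 (by linarith : -g ≤ 0)
        rw [Real.mul_rpow (by norm_num) hz0.le, Real.rpow_neg (by norm_num : (0 : ℝ) ≤ 3),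
          inv_mul_eq_div, div_le_iff₀ (by positivity)] at this
        linarith
      have h5 := hlogle hz0 h1
      rw [h3, div_mul_eq_mul_div, le_div_iff₀ hl]
      calc (analyticOrderNatAt h z : ℝ) * ‖z‖ ^ (-g) * Real.log (3 / 2)
          ≤ (analyticOrderNatAt h z : ℝ) * (3 ^ g * r n ^ (-g)) * Real.log (r n / ‖z‖) := by
            have := hr0 n
            gcongr
        _ = _ := by ring
    choose! n hn using hscale
    -- Only finitely many scales occur for a finite set of zeros.
    set m := S.sup n + 1 with hm
    have hrow : ∀ k, ∑ z ∈ S, F z k ≤ D * K * r k ^ γ := fun k => by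
      simp only [hF]
      rw [← Finset.sum_filter]
      exact sum_order_mul_log_le hξ hα hβ hd h0 hK hlog (hr0 k) (hr34 k) _
        fun z hz => (Finset.mem_filter.1 hz).2
    have hc : 0 < 3 ^ g / Real.log (3 / 2) := by positivity
    calc ∑ z ∈ S, (analyticOrderNatAt h z : ℝ) * ‖z‖ ^ (-g)
        ≤ ∑ z ∈ S, 3 ^ g / Real.log (3 / 2) * ∑ k ∈ Finset.range m, r k ^ (-g) * F z k := by
          refine Finset.sum_le_sum fun z hz => (hn z hz).trans ?_
          refine mul_le_mul_of_nonneg_left ?_ hc.le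
          refine Finset.single_le_sum (f := fun k => r k ^ (-g) * F z k) (fun k _ => ?_)
            (Finset.mem_range.2 (Nat.lt_succ_of_le (Finset.le_sup hz)))
          exact mul_nonneg (Real.rpow_nonneg (hr0 k).le _) (hF0 z hz k)
      _ = 3 ^ g / Real.log (3 / 2) * ∑ k ∈ Finset.range m, r k ^ (-g) * ∑ z ∈ S, F z k := by
          rw [← Finset.mul_sum, Finset.sum_comm]
          simp only [Finset.mul_sum]
      _ ≤ 3 ^ g / Real.log (3 / 2) * ∑ k ∈ Finset.range m, D * K * q ^ k := by
          refine mul_le_mul_of_nonneg_left (Finset.sum_le_sum fun k _ => ?_) hc.le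
          have h1 := mul_le_mul_of_nonneg_left (hrow k) (Real.rpow_nonneg (hr0 k).le (-g))
          have h2 := mul_le_mul_of_nonneg_left (hrq k) (by positivity : 0 ≤ D * K)
          linarith
      _ ≤ 3 ^ g / Real.log (3 / 2) * (D * K * (1 - q)⁻¹) := by
          rw [← Finset.mul_sum]
          gcongr
          rw [← tsum_geometric_of_lt_one hq0.le hq1]
          exact (summable_geometric_of_lt_one hq0.le hq1).sum_le_tsum _ fun k _ => by positivity
      _ = _ := by ring

/-! ### Comparison with the full weight and conclusion. -/

lemma zeroWeight_nonneg {z : ℂ} (hz : ‖z‖ < 1) : 0 ≤ zeroWeight ξ β α γ τ z :=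
  mul_nonneg (div_nonneg (Real.rpow_nonneg (by linarith) _) (by positivity))
    (Finset.prod_nonneg fun j _ => by positivity)

lemma zeroWeight_le_of_lt (hξ : ∀ j, ‖ξ j‖ = 1) (hp : 0 ≤ α + 1 + τ) {z : ℂ} (hz : ‖z‖ < 1) :
    zeroWeight ξ β α γ τ z ≤
      (∏ j, (2 : ℝ) ^ max (β j - 1 + τ) 0) * ‖z‖ ^ (-max (γ - 1 + τ) 0) := by
  have h1 : (1 - ‖z‖) ^ (α + 1 + τ) ≤ 1 :=
    Real.rpow_le_one (by linarith) (by linarith [norm_nonneg z]) hp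
  rw [zeroWeight, Real.rpow_neg (norm_nonneg z), ← one_div, mul_comm]
  exact mul_le_mul (prod_norm_sub_rpow_le hξ (fun j => le_max_right _ _) hz)
    (div_le_div_of_nonneg_right h1 (by positivity))
    (div_nonneg (Real.rpow_nonneg (by linarith) _) (by positivity))
    (Finset.prod_nonneg fun j _ => by positivity)

lemma zeroWeight_le_of_ge (hp : 0 ≤ α + 1 + τ) {z : ℂ} (hz : ‖z‖ < 1) (hz2 : 1 / 2 ≤ ‖z‖) :
    zeroWeight ξ β α γ τ z ≤ 2 ^ max (γ - 1 + τ) 0 *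
      discWeight ξ (fun j => max (β j - 1 + τ) 0) (α + 1 + τ) z := by
  have h1 : (1 - ‖z‖) ^ (α + 1 + τ) ≤ (1 - ‖z‖ ^ 2) ^ (α + 1 + τ) :=
    Real.rpow_le_rpow (by linarith) (by nlinarith [norm_nonneg z]) hp
  have h2 : (1 - ‖z‖) ^ (α + 1 + τ) / ‖z‖ ^ max (γ - 1 + τ) 0 ≤
      2 ^ max (γ - 1 + τ) 0 * (1 - ‖z‖ ^ 2) ^ (α + 1 + τ) := by
    have h0 : 0 < ‖z‖ := by linarith
    rw [div_le_iff₀ (by positivity), mul_right_comm, ← Real.mul_rpow (by norm_num) h0.le]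
    have h3 : 1 ≤ (2 * ‖z‖) ^ max (γ - 1 + τ) 0 :=
      Real.one_le_rpow (by linarith) (le_max_right _ _)
    nlinarith [Real.rpow_nonneg (one_sub_norm_sq_pos hz).le (α + 1 + τ)]
  rw [zeroWeight, discWeight, ← mul_assoc]
  exact mul_le_mul_of_nonneg_right h2 (Finset.prod_nonneg fun j _ => by positivity)

end

theorem mainTheorem3 (N : ℕ) (ξ : Fin N → ℂ) (hξ : ∀ j, ‖ξ j‖ = 1)
    (hξ_inj : Function.Injective ξ) (α γ τ : ℝ) (β : Fin N → ℝ)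
    (hα : 0 ≤ α) (hγ : 0 ≤ γ) (hβ : ∀ j, 0 ≤ β j) (hτ0 : 0 < τ) (hτ1 : τ < 1) :
    ∃ C : ℝ, 0 < C ∧ ∀ (h : ℂ → ℂ) (K : ℝ),
      DifferentiableOn ℂ h unitDisc → h 0 = 1 →
      (∀ z ∈ unitDisc, h z ≠ 0 →
        Real.log ‖h z‖ ≤
          K * (‖z‖ ^ γ / (1 - ‖z‖) ^ α) * ∏ j, 1 / ‖z - ξ j‖ ^ β j) →
      Summable (fun z : {z : ℂ // z ∈ unitDisc ∧ h z = 0} =>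
        (analyticOrderNatAt h z : ℝ) * zeroWeight ξ β α γ τ z) ∧
      ∑' z : {z : ℂ // z ∈ unitDisc ∧ h z = 0},
        (analyticOrderNatAt h z : ℝ) * zeroWeight ξ β α γ τ z ≤ C * K := by

  classical
  obtain ⟨C₁, hC₁, H₁⟩ := exists_sum_order_mul_discWeight_le_mul hξ hξ_inj hα hγ hβ hτ0 hτ1
  obtain ⟨C₂, hC₂, H₂⟩ := exists_sum_order_mul_rpow_le hξ hα hγ hβ hτ1
  have hp : 0 ≤ α + 1 + τ := by linarith
  set B : ℝ := ∏ j, (2 : ℝ) ^ max (β j - 1 + τ) 0 with hB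
  have hB0 : 0 < B := Finset.prod_pos fun j _ => by positivity
  set A : ℝ := 2 ^ max (γ - 1 + τ) 0 with hA
  have hA0 : 0 < A := by positivity
  -- The zeros are split at `|z| = 1/2`: `A * C₁` accounts for the outer ones, `B * C₂` for the
  -- inner ones. A bound uniform over finite sets yields both summability and the estimate of the
  -- sum.
  refine ⟨A * C₁ + B * C₂, by positivity, fun h K hd h0 hlog => ?_⟩
  have hlog' : ∀ z ∈ unitDisc, h z ≠ 0 → Real.log ‖h z‖ ≤ K * growthBound ξ β α γ z :=
    fun z hz hz0 => (hlog z hz hz0).trans_eq (mul_assoc _ _ _)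
  have hK := nonneg_of_log_norm_le hξ hd h0 hlog'
  have hnonneg : ∀ z : {z : ℂ // z ∈ unitDisc ∧ h z = 0},
      0 ≤ (analyticOrderNatAt h z : ℝ) * zeroWeight ξ β α γ τ z := fun z =>
    mul_nonneg (Nat.cast_nonneg _) (zeroWeight_nonneg (mem_unitDisc.1 z.2.1))
  have hsum : ∀ s : Finset {z : ℂ // z ∈ unitDisc ∧ h z = 0},
      ∑ z ∈ s, (analyticOrderNatAt h z : ℝ) * zeroWeight ξ β α γ τ z ≤
        (A * C₁ + B * C₂) * K := fun s => by
    set S : Finset ℂ := s.map (Function.Embedding.subtype _) with hS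
    have hSmem : ∀ z ∈ S, ‖z‖ < 1 ∧ h z = 0 := fun z hz => by
      obtain ⟨w, _, rfl⟩ := Finset.mem_map.1 hz
      exact ⟨mem_unitDisc.1 w.2.1, w.2.2⟩
    have e : ∑ z ∈ s, (analyticOrderNatAt h z : ℝ) * zeroWeight ξ β α γ τ z =
        ∑ z ∈ S, (analyticOrderNatAt h z : ℝ) * zeroWeight ξ β α γ τ z := by
      rw [hS, Finset.sum_map]
      rfl
    rw [e, ← Finset.sum_filter_add_sum_filter_not S fun z => ‖z‖ < 1 / 2]
    have h1 := H₁ h K (S.filter fun z => ¬ ‖z‖ < 1 / 2) hd h0 hK hlog'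
      fun z hz => hSmem z (Finset.mem_filter.1 hz).1
    have h2 := H₂ h K (S.filter fun z => ‖z‖ < 1 / 2) hd h0 hK hlog'
      fun z hz => ⟨(Finset.mem_filter.1 hz).2, (hSmem z (Finset.mem_filter.1 hz).1).2⟩
    have h3 : ∑ z ∈ S with ‖z‖ < 1 / 2,
        (analyticOrderNatAt h z : ℝ) * zeroWeight ξ β α γ τ z ≤ B * (C₂ * K) := by
      refine le_trans ?_ (mul_le_mul_of_nonneg_left h2 hB0.le)
      rw [Finset.mul_sum]
      refine Finset.sum_le_sum fun z hz => ?_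
      rw [mul_left_comm]
      exact mul_le_mul_of_nonneg_left
        (zeroWeight_le_of_lt hξ hp (hSmem z (Finset.mem_filter.1 hz).1).1) (Nat.cast_nonneg _)
    have h4 : ∑ z ∈ S with ¬ ‖z‖ < 1 / 2,
        (analyticOrderNatAt h z : ℝ) * zeroWeight ξ β α γ τ z ≤ A * (C₁ * K) := by
      refine le_trans ?_ (mul_le_mul_of_nonneg_left h1 hA0.le)
      rw [Finset.mul_sum]
      refine Finset.sum_le_sum fun z hz => ?_
      rw [mul_left_comm]
      exact mul_le_mul_of_nonneg_left
        (zeroWeight_le_of_ge hp (hSmem z (Finset.mem_filter.1 hz).1).1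
          (not_lt.1 (Finset.mem_filter.1 hz).2)) (Nat.cast_nonneg _)
    linarith
  exact ⟨summable_of_sum_le hnonneg hsum, Real.tsum_le_of_sum_le hnonneg hsum⟩
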